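/- **Setting.** For $\ell\ge 1$ let $[0,1]^\ell$ carry the metric $\|x-y\|_1=\sum_i|x_i-y_i|$. A database $\mathcal D$ consists of $n\ge 1$ points of $[0,1]^\ell$; two databases are adjacent if they differ in at most one point. The exact answer to the distance query $y\in[0,1]^\ell$ is $F_{\mathcal D}(y)=\frac1n\sum_{x\in\mathcal D}\|x-y\|_1$. An offline mechanism is a pair $(M,Q)$ of programs for a real RAM (exact real arithmetic, $\exp$, $\log$, comparisons, indirect addressing by natural-number index registers, independent uniform $[0,1]$ random numbers; every instruction and test costs one step). The program $M$ receives $n,\ell,\mathcal D$ and the parameters $\epsilon,\delta,\beta$ (with $\delta=0$ in part 2), and releases a data structure $S$, which is a finite sequence of reals. The program $Q$ is deterministic; it receives only $S$, $\ell$ and a query $y$, and outputs a real number $Q(S,y)$. The mechanism is $(\epsilon,\delta)$-differentially private if $\Pr[M(\mathcal D)\in A]\le e^{\epsilon}\Pr[M(\mathcal D')\in A]+\delta$ for all adjacent $\mathcal D,\mathcal D'$ and all measurable sets $A$ of data structures; it is $\epsilon$-differentially private if this holds with $\delta=0$. It is $(\alpha,\beta)$-accurate if for every $\mathcal D$, with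 probability at least $1-\beta$, $|Q(S,y)-F_{\mathcal D}(y)|\le\alpha$ holds for all $y\in[0,1]^\ell$ simultaneously. **Theorem.** 1. There are programs $M,Q$ and constants $C>0$, $k\in\mathbb N$ such that for all $n,\ell\ge1$, $\epsilon>0$ and $\delta,\beta\in(0,1)$ the mechanism is $(\epsilon,\delta)$-differentially private, and there is an $\alpha>0$ with $$\alpha\le C\cdot\frac{\ell^{9/5}\,\log^{4/5}(4/\delta)\,\log^{4/5}(n\ell/\beta)}{n^{4/5}\epsilon^{4/5}}$$ for which it is $(\alpha,\beta)$-accurate and $M$ always halts within $\min\{C\,\ell^3n^2/\alpha,\;C(n\ell)^k\}$ steps. Moreover $Q$ answers each query from each released data structure within $C(n\ell)^k$ steps. 2. There are programs $M,Q$ and constants $C>0$, $k\in\mathbb N$ such that for all $n,\ell\ge1$, $\epsilon>0$ and $\beta\in(0,1)$ the mechanism is $\epsilon$-differentially private, and there is an $\alpha>0$ with $$\alpha\le C\cdot\frac{\ell^{7/3}\,\log^{2/3}(n\ell/\beta)}{n^{2/3}\epsilon^{2/3}}$$ for which it is $(\alpha,\beta)$-accurate and $M$ always halts within $\min\{C\,\ell^3n^2/\alpha,\;C(n\ell)^k\}$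 steps. Moreover $Q$ answers each query from each released data structure within $C(n\ell)^k$ steps. -/

import Mathlib

open MeasureTheory

noncomputable section

namespace DistRelease

/-! ### The machine model: a randomized real RAM with unit cost per instruction

A program is a structured imperative program. Its memory consists of natural-number index
registers, real registers, and real arrays addressed by index registers. A random instruction
delivers a fresh number, uniform in `[0,1]` and independent of all earlier ones. There is no
rounding (real to integer) instruction. -/

/-- The infinite sequence of random numbers available to a program. -/
abbrev Tape := ℕ → unitInterval

/-- The entries of the tape are independent and uniformly distributed on `[0,1]`. -/
def tapeLaw : Measure Tape := Measure.infinitePi fun _ => (volume : Measure unitInterval)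

/-- Memory: index registers `idx x`, real registers `reg r`, real arrays `arr a i`, and the
number `pos` of random numbers consumed so far. -/
structure State where
  idx : ℕ → ℕ
  reg : ℕ → ℝ
  arr : ℕ → ℕ → ℝ
  pos : ℕ

/-- Primitive instructions. In the constructors, `x y z` name index registers, `r s u` name real
registers, `a` names an array. -/
inductive Instr where
  | skip : Instr
  /-- `idx x := c` -/
  | idxConst (x c : ℕ) : Instr
  /-- `idx x := idx y + idx z` -/
  | idxAdd (x y z : ℕ) : Instr
  /-- `idx x := idx y - idx z`, truncated at `0` -/
  | idxSub (x y z : ℕ) : Instr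
  /-- `reg r := q` -/
  | const (r : ℕ) (q : ℚ) : Instr
  /-- `reg r := idx x` -/
  | cast (r x : ℕ) : Instr
  /-- `reg r := reg s + reg u` -/
  | add (r s u : ℕ) : Instr
  /-- `reg r := reg s - reg u` -/
  | sub (r s u : ℕ) : Instr
  /-- `reg r := reg s * reg u` -/
  | mul (r s u : ℕ) : Instr
  /-- `reg r := reg s / reg u` -/
  | div (r s u : ℕ) : Instr
  /-- `reg r := exp (reg s)` -/
  | exp (r s : ℕ) : Instr
  /-- `reg r := log (reg s)` -/
  | log (r s : ℕ) : Instr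
  /-- `reg r := arr a [idx x]` -/
  | load (r a x : ℕ) : Instr
  /-- `arr a [idx x] := reg r` -/
  | store (a x r : ℕ) : Instr
  /-- `reg r :=` a fresh random number -/
  | rand (r : ℕ) : Instr

/-- The effect of a primitive instruction. -/
def Instr.apply (ω : Tape) (m : State) : Instr → State
  | skip => m
  | idxConst x c => { m with idx := Function.update m.idx x c }
  | idxAdd x y z => { m with idx := Function.update m.idx x (m.idx y + m.idx z) }
  | idxSub x y z => { m with idx := Function.update m.idx x (m.idx y - m.idx z) }
  | const r q => { m with reg := Function.update m.reg r (q : ℝ) }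
  | cast r x => { m with reg := Function.update m.reg r (m.idx x : ℝ) }
  | add r s u => { m with reg := Function.update m.reg r (m.reg s + m.reg u) }
  | sub r s u => { m with reg := Function.update m.reg r (m.reg s - m.reg u) }
  | mul r s u => { m with reg := Function.update m.reg r (m.reg s * m.reg u) }
  | div r s u => { m with reg := Function.update m.reg r (m.reg s / m.reg u) }
  | exp r s => { m with reg := Function.update m.reg r (Real.exp (m.reg s)) }
  | log r s => { m with reg := Function.update m.reg r (Real.log (m.reg s)) }
  | load r a x => { m with reg := Function.update m.reg r (m.arr a (m.idx x)) }
  | store a x r =>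
      { m with arr := Function.update m.arr a (Function.update (m.arr a) (m.idx x) (m.reg r)) }
  | rand r => { m with reg := Function.update m.reg r (ω m.pos : ℝ), pos := m.pos + 1 }

/-- The tests `idx x < idx y` and `reg r ≤ reg s`. -/
inductive Test where
  | idxLt (x y : ℕ) : Test
  | regLe (r s : ℕ) : Test

def Test.Holds (m : State) : Test → Prop
  | idxLt x y => m.idx x < m.idx y
  | regLe r s => m.reg r ≤ m.reg s

/-- Programs. -/
inductive Program where
  | instr (i : Instr) : Program
  | seq (p q : Program) : Program
  | ite (b : Test) (p q : Program) : Program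
  | while (b : Test) (p : Program) : Program

/-- `Exec ω p m m' t`: on the tape `ω`, the program `p` started in memory `m` halts in memory `m'`
after exactly `t` steps, where every instruction and every evaluation of a test is one step. -/
inductive Exec (ω : Tape) : Program → State → State → ℕ → Prop where
  | instr (i : Instr) (m : State) : Exec ω (.instr i) m (i.apply ω m) 1
  | seq {p q : Program} {m m' m'' : State} {t t' : ℕ} :
      Exec ω p m m' t → Exec ω q m' m'' t' → Exec ω (.seq p q) m m'' (t + t')
  | iteTrue {b : Test} {p q : Program} {m m' : State} {t : ℕ} :
      b.Holds m → Exec ω p m m' t → Exec ω (.ite b p q) m m' (t + 1)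
  | iteFalse {b : Test} {p q : Program} {m m' : State} {t : ℕ} :
      ¬ b.Holds m → Exec ω q m m' t → Exec ω (.ite b p q) m m' (t + 1)
  | whileTrue {b : Test} {p : Program} {m m' m'' : State} {t t' : ℕ} :
      b.Holds m → Exec ω p m m' t → Exec ω (.while b p) m' m'' t' →
      Exec ω (.while b p) m m'' (t + t' + 1)
  | whileFalse {b : Test} {p : Program} {m : State} :
      ¬ b.Holds m → Exec ω (.while b p) m m 1

/-- Final memory and running time are determined by the program, the input and the tape. -/
theorem Exec.unique {ω : Tape} {p : Program} {m m₁ : State} {t₁ : ℕ} (h : Exec ω p m m₁ t₁) :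
    ∀ {m₂ : State} {t₂ : ℕ}, Exec ω p m m₂ t₂ → m₁ = m₂ ∧ t₁ = t₂ := by
  induction h with
  | instr i m => intro _ _ h'; cases h'; exact ⟨rfl, rfl⟩
  | seq _ _ ih ih' =>
    intro _ _ h'
    cases h' with
    | seq a b =>
      obtain ⟨rfl, rfl⟩ := ih a
      obtain ⟨rfl, rfl⟩ := ih' b
      exact ⟨rfl, rfl⟩
  | iteTrue hb _ ih =>
    intro _ _ h'
    cases h' with
    | iteTrue _ a => obtain ⟨rfl, rfl⟩ := ih a; exact ⟨rfl, rfl⟩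
    | iteFalse hb' _ => exact absurd hb hb'
  | iteFalse hb _ ih =>
    intro _ _ h'
    cases h' with
    | iteTrue hb' _ => exact absurd hb' hb
    | iteFalse _ a => obtain ⟨rfl, rfl⟩ := ih a; exact ⟨rfl, rfl⟩
  | whileTrue hb _ _ ih ih' =>
    intro _ _ h'
    cases h' with
    | whileTrue _ a b =>
      obtain ⟨rfl, rfl⟩ := ih a
      obtain ⟨rfl, rfl⟩ := ih' b
      exact ⟨rfl, rfl⟩
    | whileFalse hb' => exact absurd hb hb'
  | whileFalse hb =>
    intro _ _ h'
    cases h' with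
    | whileTrue hb' _ _ => exact absurd hb' hb
    | whileFalse _ => exact ⟨rfl, rfl⟩

/-! ### Databases and distance queries -/

/-- A point of the cube `[0,1]^ℓ`. -/
abbrev Point (ℓ : ℕ) := Fin ℓ → unitInterval

/-- The `ℓ₁` distance. -/
def l1Dist {ℓ : ℕ} (x y : Point ℓ) : ℝ := ∑ i, |(x i : ℝ) - (y i : ℝ)|

/-- A database of `n` points. -/
abbrev Database (n ℓ : ℕ) := Fin n → Point ℓ

open Classical in
/-- Databases are adjacent if they differ in at most one element. -/
def Adjacent {n ℓ : ℕ} (D D' : Database n ℓ) : Prop := hammingDist D D' ≤ 1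

/-- The exact answer to the distance query `y`: the average distance from `y` to the database. -/
def answer {n ℓ : ℕ} (D : Database n ℓ) (y : Point ℓ) : ℝ := (∑ j, l1Dist (D j) y) / n

/-! ### Offline mechanisms -/

/-- What an offline mechanism releases: a finite sequence of reals. -/
abbrev DataStructure := Σ s : ℕ, (Fin s → ℝ)

/-- Initial memory of a release program: `idx 0 = n`, `idx 1 = ℓ`, `reg 0 = ε`, `reg 1 = δ`,
`reg 2 = β`, and coordinate `i` of data point `j` is entry `j * ℓ + i` of array `0`. All else
is `0`. -/
def releaseInput {n ℓ : ℕ} (ε δ β : ℝ) (D : Database n ℓ) : State where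
  idx x := if x = 0 then n else if x = 1 then ℓ else 0
  reg r := if r = 0 then ε else if r = 1 then δ else if r = 2 then β else 0
  arr a i := if h : a = 0 ∧ i < n * ℓ then
      (D ⟨i / ℓ, Nat.div_lt_of_lt_mul (by rw [Nat.mul_comm]; exact h.2)⟩
        ⟨i % ℓ, Nat.mod_lt _ (Nat.pos_of_mul_pos_left (Nat.zero_lt_of_lt h.2))⟩ : ℝ)
    else 0
  pos := 0

/-- The released data structure: the first `idx 0` entries of array `1` of the final memory. -/
def releaseOutput (m : State) : DataStructure := ⟨m.idx 0, fun i => m.arr 1 i⟩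

/-- On the tape `ω`, the release program `M` halts after `t` steps and releases `S`. -/
def Releases (M : Program) {n ℓ : ℕ} (ε δ β : ℝ) (D : Database n ℓ) (ω : Tape)
    (S : DataStructure) (t : ℕ) : Prop :=
  ∃ m, Exec ω M (releaseInput ε δ β D) m t ∧ releaseOutput m = S

/-- Initial memory of a query program: `idx 0` is the length of the data structure, `idx 1 = ℓ`,
array `0` holds the data structure and array `1` the query point. All else is `0`: the database is
not available. -/
def queryInput {ℓ : ℕ} (S : DataStructure) (y : Point ℓ) : State where
  idx x := if x = 0 then S.1 else if x = 1 then ℓ else 0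
  reg _ := 0
  arr a i :=
    if h : a = 0 ∧ i < S.1 then S.2 ⟨i, h.2⟩
    else if h : a = 1 ∧ i < ℓ then (y ⟨i, h.2⟩ : ℝ)
    else 0
  pos := 0

/-- The query program `Q` answers the query `y` from the data structure `S` by the number `v`
(left in `reg 0`) after `t` steps. Query programs are deterministic: their tape is constant. -/
def Answers (Q : Program) {ℓ : ℕ} (S : DataStructure) (y : Point ℓ) (v : ℝ) (t : ℕ) : Prop :=
  ∃ m, Exec (fun _ => 0) Q (queryInput S y) m t ∧ m.reg 0 = v

/-- `(ε, δ)`-differential privacy of the data structure released by `M` (run with the privacy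
parameters `ε`, `δ` and the failure probability `β` as inputs), on databases of `n` points in
`[0,1]^ℓ`. -/
def IsDP (M : Program) (n ℓ : ℕ) (ε δ β : ℝ) : Prop :=
  ∀ D D' : Database n ℓ, Adjacent D D' → ∀ A : Set DataStructure, MeasurableSet A →
    tapeLaw {ω | ∃ S ∈ A, ∃ t, Releases M ε δ β D ω S t} ≤
      ENNReal.ofReal (Real.exp ε) * tapeLaw {ω | ∃ S ∈ A, ∃ t, Releases M ε δ β D' ω S t} +
        ENNReal.ofReal δ

/-- `(α, β)`-accuracy for all queries at once: except with probability at most `β`, the released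
data structure lets `Q` answer every query in `[0,1]^ℓ` up to an additive error `α`. -/
def IsAccurate (M Q : Program) (n ℓ : ℕ) (ε δ β α : ℝ) : Prop :=
  ∀ D : Database n ℓ,
    tapeLaw {ω | ¬ ∃ S t, Releases M ε δ β D ω S t ∧
      ∀ y : Point ℓ, ∃ v t', Answers Q S y v t' ∧ |v - answer D y| ≤ α} ≤ ENNReal.ofReal β

/-- For every database and all outcomes of the random numbers, `M` halts within `T` steps, and `Q`
answers every query from the released data structure within `T'` steps. -/
def RunsWithin (M Q : Program) (n ℓ : ℕ) (ε δ β T T' : ℝ) : Prop :=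
  ∀ (D : Database n ℓ) (ω : Tape), ∃ S t, Releases M ε δ β D ω S t ∧ (t : ℝ) ≤ T ∧
    ∀ y : Point ℓ, ∃ v t', Answers Q S y v t' ∧ (t' : ℝ) ≤ T'

end DistRelease

end

noncomputable section

namespace DistRelease

/-! One mechanism, private with δ = 0, serves both parts. Write u = ℓ log(nℓ/β)/(nε) (`errorScale`).
The distance splits over coordinates, so it suffices to release, for each coordinate, the average of
y ↦ |x - y| over the data.

For fixed x this function of y is expanded in hat functions over dyadic intervals. The coefficient
at midpoint m and half-width h is a second difference of |x - ·| and equals min(h, |x - m|) - h. It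
vanishes unless x lies in the interval. Truncating the expansion gives linear interpolation on a
dyadic grid (`exists_sum_nodeTerm_eq_interpolation`). Changing x moves the statistics of level i by
at most 2^(-i) in total, while at most one hat of each level is nonzero at a given y. Noise of size
(3/4)^i on level i therefore keeps both the privacy cost, Σ 2^(-i)/(3/4)^i
(`sum_abs_truncDist_sub_div_nodeB_le`), and the error, Σ (3/4)^i (`sum_nodeB_mul_le`), bounded
independently of the depth. Stopping at intervals of length about u gives error O(ℓu), which is
O(ℓu^r) for r ≤ 1 when u < 1.

This tree has about 1/u nodes per coordinate, which is not polynomial for tiny u. So there are three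
regimes. If u ≥ 1, nothing is released and the answer 0 is good enough. If n^5 u ≤ 1, every
coordinate of every point is released with noise, at error O(ℓnu), and nu ≤ u^(4/5) holds there.
Otherwise the tree is used, with at most 2n^5 nodes per coordinate.

The noise is logistic: a shift by a acts on the underlying uniform variable by a Möbius map of [0,1]
that raises measures of preimages by at most e^|a| (`pi_logistic_shift_le`), which yields privacy
through `isDP_of_releases_records`. -/

/-! ### Logistic noise -/

/-- A standard logistic variable, obtained from a uniform one by inverting the distribution
function. -/
def logistic (u : unitInterval) : ℝ := Real.log ((u : ℝ) / (1 - u))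

theorem measurable_logistic : Measurable logistic := by
  unfold logistic
  fun_prop

theorem one_add_mul_pos {c : ℝ} (hc : 0 < c) (u : unitInterval) : 0 < 1 + (c - 1) * (u : ℝ) := by
  have h0 := u.2.1
  rcases u.2.2.lt_or_eq with h | h
  · nlinarith [mul_nonneg hc.le h0]
  · rw [h]; linarith

/-- The map of `[0,1]` that shifts the logistic variable by `log c`. -/
def oddsScale (c : ℝ) (hc : 0 < c) (u : unitInterval) : unitInterval :=
  ⟨c * u / (1 + (c - 1) * u), by
    have h0 := u.2.1
    have h1 := u.2.2
    have hd := one_add_mul_pos hc u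
    constructor
    · positivity
    · rw [div_le_one hd]; linarith⟩

/-- On the odds u/(1 - u) the map is multiplication by c. The endpoints are excluded because the
conventions for division by zero and `Real.log 0` break the identity there. -/
theorem logistic_oddsScale {c : ℝ} (hc : 0 < c) {u : unitInterval} (h0 : (u : ℝ) ≠ 0)
    (h1 : (u : ℝ) ≠ 1) : logistic (oddsScale c hc u) = logistic u + Real.log c := by
  have hd := one_add_mul_pos hc u
  have h1' : 1 - (u : ℝ) ≠ 0 := sub_ne_zero.2 (Ne.symm h1)
  have : c * u / (1 + (c - 1) * u) / (1 - c * u / (1 + (c - 1) * u)) = (u : ℝ) / (1 - u) * c := by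
    have h2 : 1 - c * u / (1 + (c - 1) * u) = (1 - u) / (1 + (c - 1) * (u : ℝ)) := by
      rw [eq_div_iff hd.ne', sub_mul, div_mul_cancel₀ _ hd.ne']
      ring
    rw [h2, div_div_div_cancel_right₀ hd.ne']
    ring
  rw [logistic, oddsScale, this, logistic, Real.log_mul (div_ne_zero h0 h1') hc.ne']

/-- The difference quotient is c divided by a product of two factors lying between 1 and c, hence at
least min(c, 1/c). -/
theorem antilipschitz_oddsScale {c : ℝ} (hc : 0 < c) :
    AntilipschitzWith (Real.toNNReal (max c c⁻¹)) (oddsScale c hc) := by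
  refine AntilipschitzWith.of_le_mul_dist fun u v => ?_
  have hu := one_add_mul_pos hc u
  have hv := one_add_mul_pos hc v
  have hK : 0 < max c c⁻¹ := lt_max_of_lt_left hc
  rw [Real.coe_toNNReal _ hK.le, Subtype.dist_eq, Subtype.dist_eq, Real.dist_eq, Real.dist_eq]
  have key : ((oddsScale c hc u : unitInterval) : ℝ) - (oddsScale c hc v : unitInterval) =
      (u - v : ℝ) * (c / ((1 + (c - 1) * u) * (1 + (c - 1) * (v : ℝ)))) := by
    simp only [oddsScale]
    rw [div_sub_div _ _ hu.ne' hv.ne', mul_div_assoc']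
    congr 1
    ring
  rw [key, abs_mul, abs_of_pos (by positivity : 0 < c / ((1 + (c - 1) * u) * (1 + (c - 1) * (v : ℝ)))),
    mul_left_comm]
  refine le_mul_of_one_le_right (abs_nonneg _) ?_
  rw [← mul_div_assoc, one_le_div (by positivity)]
  have hu0 := u.2.1
  have hu1 := u.2.2
  have hv0 := v.2.1
  have hv1 := v.2.2
  rcases le_total 1 c with h | h
  · have h1 : 1 + (c - 1) * (u : ℝ) ≤ c := by nlinarith
    have h2 : 1 + (c - 1) * (v : ℝ) ≤ c := by nlinarith
    exact (mul_le_mul h1 h2 hv.le hc.le).trans (by gcongr; exact le_max_left _ _)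
  · have h1 : 1 + (c - 1) * (u : ℝ) ≤ 1 := by nlinarith
    have h2 : 1 + (c - 1) * (v : ℝ) ≤ 1 := by nlinarith
    refine (mul_le_mul h1 h2 hv.le zero_le_one).trans ?_
    rw [one_mul, ← inv_mul_cancel₀ hc.ne']
    gcongr
    exact le_max_right _ _

/-- In the form of Hausdorff measure, the antilipschitz bound controls preimages of arbitrary sets,
without densities or a change of variables. -/
theorem volume_eq_hausdorffMeasure_unitInterval (s : Set unitInterval) :
    volume s = Measure.hausdorffMeasure 1 s := by
  rw [unitInterval.volume_apply, ← hausdorffMeasure_real]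
  exact isometry_subtype_coe.hausdorffMeasure_image (Or.inl zero_le_one) s

theorem volume_preimage_oddsScale_le (a : ℝ) (s : Set unitInterval) :
    volume (oddsScale (Real.exp a) (Real.exp_pos a) ⁻¹' s) ≤
      ENNReal.ofReal (Real.exp |a|) * volume s := by
  have h := (antilipschitz_oddsScale (Real.exp_pos a)).hausdorffMeasure_preimage_le
    zero_le_one s
  have hm : max (Real.exp a) (Real.exp a)⁻¹ = Real.exp |a| := by
    rw [← Real.exp_neg, ← Real.exp_monotone.map_max]; rfl
  rw [volume_eq_hausdorffMeasure_unitInterval, volume_eq_hausdorffMeasure_unitInterval]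
  simpa [hm, ENNReal.ofReal] using h

theorem ae_ne_zero_one : ∀ᵐ u : unitInterval, (u : ℝ) ≠ 0 ∧ (u : ℝ) ≠ 1 := by
  have h : ∀ v : unitInterval, ∀ᵐ u : unitInterval, u ≠ v := fun v => by
    rw [ae_iff]
    simp
  filter_upwards [h 0, h 1] with u h0 h1
  exact ⟨fun h => h0 (Subtype.ext h), fun h => h1 (Subtype.ext h)⟩

/-- Shifting the components of a vector of independent logistic variables increases the
probability of no set by more than the exponential of the sum of the shifts. -/
theorem pi_logistic_shift_le {ι : Type*} [Fintype ι] (a : ι → ℝ) (B : Set (ι → ℝ)) :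
    Measure.pi (fun _ : ι => (volume : Measure unitInterval))
        {u | (fun k => logistic (u k) + a k) ∈ B} ≤
      ENNReal.ofReal (Real.exp (∑ k, |a k|)) *
        Measure.pi (fun _ : ι => (volume : Measure unitInterval))
          {u | (fun k => logistic (u k)) ∈ B} := by
  set P := Measure.pi (fun _ : ι => (volume : Measure unitInterval)) with hP
  set Φ : (ι → unitInterval) → ι → unitInterval :=
    fun u k => oddsScale (Real.exp (a k)) (Real.exp_pos _) (u k) with hΦ
  set c : ENNReal := ENNReal.ofReal (Real.exp (∑ k, |a k|)) with hc
  have hc0 : c ≠ 0 := by simp [hc, Real.exp_pos]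
  have hct : c ≠ ⊤ := ENNReal.ofReal_ne_top
  have hcp : c = ∏ k, ENNReal.ofReal (Real.exp |a k|) := by
    rw [hc, Real.exp_sum, ENNReal.ofReal_prod_of_nonneg fun _ _ => (Real.exp_pos _).le]
  -- `OuterMeasure.pi` is the largest outer measure bounded by the products on boxes, so an
  -- inequality checked on boxes passes to all sets, measurable or not.
  have main : ∀ S, P (Φ ⁻¹' S) ≤ c * P S := by
    have hle : c⁻¹ • OuterMeasure.map Φ P.toOuterMeasure ≤
        OuterMeasure.pi fun _ : ι => (volume : Measure unitInterval).toOuterMeasure := by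
      rw [OuterMeasure.le_pi]
      intro s _
      have h1 : Φ ⁻¹' Set.univ.pi s =
          Set.univ.pi fun k => oddsScale (Real.exp (a k)) (Real.exp_pos _) ⁻¹' s k := by
        ext u; simp [hΦ]
      have h2 : P (Φ ⁻¹' Set.univ.pi s) ≤ c * ∏ k, volume (s k) := by
        rw [h1, hP, Measure.pi_pi, hcp, ← Finset.prod_mul_distrib]
        exact Finset.prod_le_prod' fun k _ => volume_preimage_oddsScale_le _ _
      change c⁻¹ * P (Φ ⁻¹' Set.univ.pi s) ≤ _
      rw [mul_comm, ← div_eq_mul_inv]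
      exact ENNReal.div_le_of_le_mul' h2
    intro S
    have h := hle S
    have hPS : (OuterMeasure.pi fun _ : ι => (volume : Measure unitInterval).toOuterMeasure) S
        ≤ P S := by
      rw [hP, Measure.pi]
      exact le_toMeasure_apply _ _ S
    have h3 : c⁻¹ * P (Φ ⁻¹' S) ≤ P S := le_trans h hPS
    calc P (Φ ⁻¹' S) = c * (c⁻¹ * P (Φ ⁻¹' S)) := by
          rw [← mul_assoc, ENNReal.mul_inv_cancel hc0 hct, one_mul]
      _ ≤ c * P S := by gcongr
  refine le_trans (measure_mono_ae ?_) (main _)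
  have hgood : ∀ᵐ u ∂P, ∀ k, (u k : ℝ) ≠ 0 ∧ (u k : ℝ) ≠ 1 :=
    ae_all_iff.2 fun k =>
      (Measure.quasiMeasurePreserving_eval (fun _ : ι => (volume : Measure unitInterval)) k).ae
        ae_ne_zero_one
  filter_upwards [hgood] with u hu hB
  change (fun k => logistic (Φ u k)) ∈ B
  convert (show (fun k => logistic (u k) + a k) ∈ B from hB) using 2 with k
  rw [hΦ]
  simp only
  rw [logistic_oddsScale (Real.exp_pos _) (hu k).1 (hu k).2, Real.log_exp]

theorem volume_lt_abs_logistic_le (t : ℝ) :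
    volume {u : unitInterval | t < |logistic u|} ≤ ENNReal.ofReal (2 / (1 + Real.exp t)) := by
  set p : ℝ := 1 / (1 + Real.exp t) with hp
  have he := Real.exp_pos t
  have hp0 : 0 < p := by positivity
  have hp1 : p ≤ 1 := by rw [hp, div_le_one (by positivity)]; linarith
  let v : unitInterval := ⟨p, hp0.le, hp1⟩
  have hsub : {u : unitInterval | t < |logistic u|} ⊆ Set.Iic v ∪ Set.Ici (unitInterval.symm v) := by
    intro u hu
    by_contra hcon
    simp only [Set.mem_union, Set.mem_Iic, Set.mem_Ici, not_or, not_le] at hcon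
    have h1 : p < (u : ℝ) := hcon.1
    have h2 : (u : ℝ) < 1 - p := hcon.2
    have hu0 : 0 < (u : ℝ) := hp0.trans h1
    have hu1 : 0 < 1 - (u : ℝ) := by linarith
    have hpe : p * (1 + Real.exp t) = 1 := by rw [hp]; field_simp
    refine (not_lt.2 (abs_le.2 ⟨?_, ?_⟩)) (Set.mem_ofPred_eq ▸ hu)
    · rw [logistic, Real.le_log_iff_exp_le (by positivity), Real.exp_neg, le_div_iff₀ hu1,
        inv_mul_le_iff₀ he]
      nlinarith
    · rw [logistic, Real.log_le_iff_le_exp (by positivity), div_le_iff₀ hu1]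
      nlinarith
  refine (measure_mono hsub).trans ((measure_union_le _ _).trans ?_)
  rw [unitInterval.volume_Iic, unitInterval.volume_Ici, ← ENNReal.ofReal_add hp0.le (by simp [v, hp0.le])]
  refine ENNReal.ofReal_le_ofReal (le_of_eq ?_)
  simp [v, hp]
  ring

instance : IsProbabilityMeasure tapeLaw := by
  unfold tapeLaw; infer_instance

/-- All of the first `N` logistic variables are bounded by `t`, with high probability. -/
theorem tapeLaw_exists_lt_abs_logistic_le (N : ℕ) (t : ℝ) :
    tapeLaw {ω | ∃ k < N, t < |logistic (ω k)|} ≤ ENNReal.ofReal (N * (2 / (1 + Real.exp t))) := by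
  have hset : {ω : Tape | ∃ k < N, t < |logistic (ω k)|} =
      ⋃ k ∈ Finset.range N, (fun ω : Tape => ω k) ⁻¹' {u | t < |logistic u|} := by
    ext ω; simp
  have hm : MeasurableSet {u : unitInterval | t < |logistic u|} :=
    measurableSet_lt measurable_const measurable_logistic.abs
  rw [hset]
  refine (measure_biUnion_finset_le _ _).trans ?_
  have : ∀ k ∈ Finset.range N, tapeLaw ((fun ω : Tape => ω k) ⁻¹' {u | t < |logistic u|}) ≤
      ENNReal.ofReal (2 / (1 + Real.exp t)) := fun k _ => by
    have := (measurePreserving_eval_infinitePi (fun _ : ℕ => (volume : Measure unitInterval)) k)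
    rw [tapeLaw]
    exact (this.measure_preimage hm.nullMeasurableSet).trans_le (volume_lt_abs_logistic_le t)
  refine (Finset.sum_le_sum this).trans ?_
  rw [Finset.sum_const, Finset.card_range, nsmul_eq_mul, ENNReal.ofReal_mul (Nat.cast_nonneg N),
    ENNReal.ofReal_natCast]

/-! ### Data structures made of noisy statistics -/

/-- The data structure made of `N` records of four numbers; entry `c` of record `k` is the affine
function `A k c + B k c * z k` of the noisy statistic `z k`. -/
def records (N : ℕ) (A B : ℕ → ℕ → ℝ) (z : ℕ → ℝ) : DataStructure :=
  ⟨4 * N, fun i => A (i / 4) (i % 4) + B (i / 4) (i % 4) * z (i / 4)⟩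

/-- Privacy by post-processing: `A`, `B` and `b` do not depend on the database, so the release is
one fixed measurable function of the vector `logistic (ω k) + q D k / b k`. An adjacent database
shifts that vector by at most ε in ℓ₁ norm. -/
theorem isDP_of_releases_records {M : Program} {n ℓ : ℕ} {ε δ β : ℝ} (N : ℕ)
    (A B : ℕ → ℕ → ℝ) (q : Database n ℓ → ℕ → ℝ) (b : ℕ → ℝ) (hb : ∀ k, 0 < b k)
    (hM : ∀ D ω, ∃ t, Releases M ε δ β D ω
      (records N A B fun k => q D k + logistic (ω k) * b k) t)
    (hq : ∀ D D', Adjacent D D' → ∑ k ∈ Finset.range N, |q D k - q D' k| / b k ≤ ε) :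
    IsDP M n ℓ ε δ β := by
  intro D D' hD E hE
  set G : (Finset.range N → ℝ) → DataStructure := fun z =>
    records N A B fun k => if h : k ∈ Finset.range N then z ⟨k, h⟩ else 0 with hG
  have hrec : ∀ z, records N A B z = G fun k => z k := by
    intro z
    simp only [hG, records, Sigma.mk.injEq, true_and, heq_eq_eq]
    funext i
    have : (i : ℕ) / 4 < N := by omega
    simp [this]
  have hGm : Measurable G := by
    intro s hs
    have hs' : MeasurableSet (Sigma.mk (4 * N) ⁻¹' s) :=
      MeasurableSpace.measurableSet_iInf.1 hs (4 * N)
    have hG' : G ⁻¹' s = (fun (z : Finset.range N → ℝ) (i : Fin (4 * N)) =>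
        A (i / 4) (i % 4) + B (i / 4) (i % 4) *
          (if h : (i : ℕ) / 4 ∈ Finset.range N then z ⟨i / 4, h⟩ else 0)) ⁻¹'
        (Sigma.mk (β := fun s : ℕ => Fin s → ℝ) (4 * N) ⁻¹' s) := rfl
    rw [hG']
    refine Measurable.comp (g := fun v => v) measurable_id ?_ hs'
    refine measurable_pi_lambda _ fun i => ?_
    refine measurable_const.add (measurable_const.mul ?_)
    split
    · exact measurable_pi_apply _
    · exact measurable_const
  have hset : ∀ D, {ω | ∃ S ∈ E, ∃ t, Releases M ε δ β D ω S t} =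
      (Finset.range N).restrict ⁻¹'
        {u | (fun k : Finset.range N => logistic (u k) + q D k / b k) ∈
          {x | G (fun k => x k * b k) ∈ E}} := by
    intro D
    ext ω
    obtain ⟨t, m, hm, hS⟩ := hM D ω
    rw [hrec] at hS
    have hcong : G (fun k : Finset.range N => q D k + logistic (ω k) * b k) =
        G (fun k => (logistic (ω k) + q D k / b k) * b k) := by
      have hz : (fun k : Finset.range N => q D k + logistic (ω k) * b k) =
          fun k : Finset.range N => (logistic (ω k) + q D k / b k) * b k := by
        funext k
        rw [add_mul, div_mul_cancel₀ _ (hb k).ne', add_comm]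
      rw [hz]
    constructor
    · rintro ⟨S, hSE, t', m', hm', hS'⟩
      obtain ⟨rfl, -⟩ := hm.unique hm'
      simp only [Set.mem_preimage, Set.mem_ofPred_eq, Finset.restrict]
      rw [← hcong, ← hS, hS']
      exact hSE
    · intro h
      refine ⟨_, ?_, t, m, hm, hS⟩
      rw [hcong]
      simpa only [Set.mem_preimage, Set.mem_ofPred_eq, Finset.restrict] using h
  have hlaw : ∀ D, tapeLaw {ω | ∃ S ∈ E, ∃ t, Releases M ε δ β D ω S t} =
      Measure.pi (fun _ : Finset.range N => (volume : Measure unitInterval))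
        {u | (fun k : Finset.range N => logistic (u k) + q D k / b k) ∈
          {x | G (fun k => x k * b k) ∈ E}} := by
    intro D
    -- Only the first `N` random numbers matter, so the infinite product reduces to a finite one.
    rw [hset, tapeLaw, ← Measure.infinitePi_map_restrict (fun _ : ℕ => (volume : Measure unitInterval)),
      Measure.map_apply]
    · exact Finset.measurable_restrict _
    · have hm : Measurable fun u : Finset.range N → unitInterval =>
          G fun k => (logistic (u k) + q D k / b k) * b k := by
        refine hGm.comp (measurable_pi_lambda (fun (u : Finset.range N → unitInterval)
          (k : Finset.range N) => (logistic (u k) + q D k / b k) * b k) fun k => ?_)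
        have h : Measurable fun u : Finset.range N → unitInterval => logistic (u k) :=
          measurable_logistic.comp (measurable_pi_apply k)
        exact (h.add_const _).mul_const _
      exact hm hE
  rw [hlaw, hlaw]
  refine le_add_right ?_
  set a : Finset.range N → ℝ := fun k => (q D k - q D' k) / b k
  have h := pi_logistic_shift_le a
    {x | G (fun k => (x k + q D' k / b k) * b k) ∈ E}
  have h1 : ∀ u : Finset.range N → unitInterval, (fun k : Finset.range N =>
      (logistic (u k) + a k + q D' k / b k) * b k) =
      fun k => (logistic (u k) + q D k / b k) * b k := by
    intro u
    funext k
    simp only [a]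
    ring
  simp only [Set.mem_ofPred_eq, h1] at h ⊢
  refine h.trans ?_
  gcongr
  refine le_trans (le_of_eq ?_) (hq D D' hD)
  rw [← Finset.sum_coe_sort (Finset.range N)]
  refine Finset.sum_congr rfl fun k _ => ?_
  rw [abs_div, abs_of_pos (hb k)]

/-! ### The hierarchical expansion of the distance on `[0,1]` -/

/-- The distance to `m`, truncated at `h`. -/
def truncDist (m h x : ℝ) : ℝ := min h |x - m|

theorem truncDist_le (m h x : ℝ) : truncDist m h x ≤ h := min_le_left _ _

theorem abs_truncDist_sub_le (m h x x' : ℝ) : |truncDist m h x - truncDist m h x'| ≤ |x - x'| := by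
  unfold truncDist
  refine (abs_min_sub_min_le_max _ _ _ _).trans ?_
  rw [sub_self, abs_zero, max_eq_right (abs_nonneg _)]
  refine (abs_abs_sub_abs_le _ _).trans (le_of_eq ?_)
  congr 1
  ring

/-- Half-width of node `v`. Node `0` is the root, carrying the linear part; node `2 ^ i + p` is the
dyadic interval number `p` of length `2 ^ (-i)`. -/
def nodeH (v : ℕ) : ℝ := if v = 0 then 1 else (1 / 2) ^ (Nat.log 2 v + 1)

/-- Midpoint of node `v`. -/
def nodeM (v : ℕ) : ℝ := if v = 0 then 0 else (2 * (v - 2 ^ Nat.log 2 v : ℝ) + 1) * nodeH v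

/-- Slope factor of node `v`. -/
def nodeG (v : ℕ) : ℝ := if v = 0 then 2 else 1 / nodeH v

/-- Offset of node `v`. -/
def nodeE (v : ℕ) : ℝ := if v = 0 then 0 else nodeH v

/-- Relative noise level of node `v`. -/
def nodeB (v : ℕ) : ℝ := if v = 0 then 1 else (3 / 4) ^ Nat.log 2 v

/-- The contribution of node `v` with statistic `s` to the estimated distance from `y`. -/
def nodeTerm (v : ℕ) (s y : ℝ) : ℝ :=
  (1 - s * nodeG v) * truncDist (nodeM v) (nodeH v) y + (s - nodeE v)

theorem nodeB_pos (v : ℕ) : 0 < nodeB v := by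
  unfold nodeB; split <;> positivity

theorem log_two_pow_add {i p : ℕ} (hp : p < 2 ^ i) : Nat.log 2 (2 ^ i + p) = i := by
  refine Nat.log_eq_of_pow_le_of_lt_pow (by omega) ?_
  rw [pow_succ]; omega

theorem two_pow_add_ne_zero (i p : ℕ) : 2 ^ i + p ≠ 0 := by positivity

theorem nodeH_eq {i p : ℕ} (hp : p < 2 ^ i) : nodeH (2 ^ i + p) = (1 / 2) ^ (i + 1) := by
  rw [nodeH, if_neg (two_pow_add_ne_zero i p), log_two_pow_add hp]

theorem nodeM_eq {i p : ℕ} (hp : p < 2 ^ i) :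
    nodeM (2 ^ i + p) = (2 * p + 1) * (1 / 2) ^ (i + 1) := by
  rw [nodeM, if_neg (two_pow_add_ne_zero i p), log_two_pow_add hp, nodeH_eq hp]
  push_cast
  ring

theorem nodeG_eq {i p : ℕ} (hp : p < 2 ^ i) : nodeG (2 ^ i + p) = 1 / (1 / 2) ^ (i + 1) := by
  rw [nodeG, if_neg (two_pow_add_ne_zero i p), nodeH_eq hp]

theorem nodeE_eq {i p : ℕ} (hp : p < 2 ^ i) : nodeE (2 ^ i + p) = (1 / 2) ^ (i + 1) := by
  rw [nodeE, if_neg (two_pow_add_ne_zero i p), nodeH_eq hp]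

theorem nodeB_eq {i p : ℕ} (hp : p < 2 ^ i) : nodeB (2 ^ i + p) = (3 / 4) ^ i := by
  rw [nodeB, if_neg (two_pow_add_ne_zero i p), log_two_pow_add hp]

/-! ### Interpolation of the distance by dyadic hat functions -/

theorem sum_range_two_pow (f : ℕ → ℝ) (I : ℕ) : ∑ v ∈ Finset.range (2 ^ I), f v =
    f 0 + ∑ i ∈ Finset.range I, ∑ p ∈ Finset.range (2 ^ i), f (2 ^ i + p) := by
  induction I with
  | zero => simp
  | succ I ih => rw [pow_succ, mul_two, Finset.sum_range_add, ih, Finset.sum_range_succ, add_assoc]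

/-- Tents over disjoint intervals of equal length sum up to at most one tent height. -/
theorem sum_tents_le {h : ℝ} (hh : 0 ≤ h) (x : ℝ) (P : ℕ) :
    ∑ p ∈ Finset.range P, (h - truncDist ((2 * p + 1) * h) h x) ≤ h ∧
      (2 * P * h ≤ x → ∑ p ∈ Finset.range P, (h - truncDist ((2 * p + 1) * h) h x) = 0) := by
  -- The second conjunct carries the induction: once x lies beyond the first `P` intervals their
  -- tents vanish, so the new tent stands alone.
  induction P with
  | zero => simp [hh]
  | succ P ih =>
    rw [Finset.sum_range_succ]
    push_cast
    refine ⟨?_, fun hx => ?_⟩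
    · rcases le_or_gt (2 * P * h) x with hx | hx
      · rw [ih.2 hx, zero_add, sub_le_self_iff]
        exact le_min hh (abs_nonneg _)
      · have : truncDist ((2 * P + 1) * h) h x = h := by
          refine min_eq_left ?_
          rw [abs_sub_comm]
          exact le_trans (by linarith) (le_abs_self _)
        rw [this, sub_self, add_zero]
        exact ih.1
    · have : truncDist ((2 * P + 1) * h) h x = h := by
        refine min_eq_left ?_
        exact le_trans (by linarith) (le_abs_self _)
      rw [this, sub_self, add_zero]
      exact ih.2 (by nlinarith)

/-- Coefficient times hat of height 1. The expression in `nodeTerm` is the same quantity in the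
shape `c * truncDist m h y + d` that a record encodes. -/
theorem nodeTerm_eq {i p : ℕ} (hp : p < 2 ^ i) (s y : ℝ) :
    nodeTerm (2 ^ i + p) s y = (s - (1 / 2) ^ (i + 1)) *
      (((1 / 2) ^ (i + 1) - truncDist ((2 * p + 1) * (1 / 2) ^ (i + 1)) ((1 / 2) ^ (i + 1)) y) /
        (1 / 2) ^ (i + 1)) := by
  have : ((1 / 2 : ℝ) ^ (i + 1)) ≠ 0 := by positivity
  rw [nodeTerm, nodeG_eq hp, nodeM_eq hp, nodeH_eq hp, nodeE_eq hp]
  generalize ((1 / 2 : ℝ) ^ (i + 1)) = h at *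
  field_simp
  ring

/-- The second difference of |x - ·| vanishes when x is at distance at least h from m, which is why
truncation keeps all the information needed. -/
theorem truncDist_sub_eq_second_difference {m h : ℝ} (hh : 0 ≤ h) (x : ℝ) :
    truncDist m h x - h = |x - m| - (|x - (m - h)| + |x - (m + h)|) / 2 := by
  unfold truncDist
  rcases le_total (x - m) 0 with h1 | h1 <;> rcases le_total (x - (m - h)) 0 with h2 | h2 <;>
    rcases le_total (x - (m + h)) 0 with h3 | h3 <;>
    simp only [abs_of_nonneg, abs_of_nonpos, h1, h2, h3, min_def] <;> split_ifs <;> linarith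

/-- The first `I` levels of the expansion interpolate the distance linearly on a dyadic interval. -/
theorem exists_sum_nodeTerm_eq_interpolation {x y : ℝ} (hx : x ∈ Set.Icc (0 : ℝ) 1)
    (hy : y ∈ Set.Icc (0 : ℝ) 1) (I : ℕ) : ∃ p : ℕ, p < 2 ^ I ∧
      p * (1 / 2 : ℝ) ^ I ≤ y ∧ y ≤ (p + 1) * (1 / 2 : ℝ) ^ I ∧
      ∑ v ∈ Finset.range (2 ^ I), nodeTerm v (truncDist (nodeM v) (nodeH v) x) y =
        (((p + 1) * (1 / 2 : ℝ) ^ I - y) * |x - p * (1 / 2 : ℝ) ^ I| +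
          (y - p * (1 / 2 : ℝ) ^ I) * |x - (p + 1) * (1 / 2 : ℝ) ^ I|) / (1 / 2 : ℝ) ^ I := by
  induction I with
  | zero =>
    -- The root contributes x + (1 - 2x)y, the chord of |x - y| between y = 0 and y = 1.
    refine ⟨0, by simp, by simpa using hy.1, by simpa using hy.2, ?_⟩
    simp [nodeTerm, nodeM, nodeH, nodeG, nodeE, truncDist, abs_of_nonneg hx.1, abs_of_nonneg hy.1,
      hx.2, hy.2, abs_of_nonpos (sub_nonpos.2 hx.2)]
    ring
  | succ I ih =>
    obtain ⟨p, hp, hy1, hy2, ih⟩ := ih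
    have hw : (1 / 2 : ℝ) ^ I = 2 * (1 / 2) ^ (I + 1) := by rw [pow_succ]; ring
    have hh : 0 < (1 / 2 : ℝ) ^ (I + 1) := by positivity
    -- Every hat of level `I` other than the one over the interval `p` containing y vanishes at y.
    have hstep : ∑ q ∈ Finset.range (2 ^ I), nodeTerm (2 ^ I + q)
        (truncDist (nodeM (2 ^ I + q)) (nodeH (2 ^ I + q)) x) y = nodeTerm (2 ^ I + p)
        (truncDist (nodeM (2 ^ I + p)) (nodeH (2 ^ I + p)) x) y := by
      refine Finset.sum_eq_single_of_mem p (Finset.mem_range.2 hp) fun q hq hqp => ?_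
      rw [nodeTerm_eq (Finset.mem_range.1 hq)]
      rw [hw] at hy1 hy2
      generalize (1 / 2 : ℝ) ^ (I + 1) = h at *
      have : truncDist ((2 * q + 1) * h) h y = h := by
        refine min_eq_left ?_
        rcases lt_or_gt_of_ne hqp with hlt | hlt
        · have : (q : ℝ) + 1 ≤ p := by exact_mod_cast hlt
          refine le_trans ?_ (le_abs_self _)
          nlinarith
        · have : (p : ℝ) + 1 ≤ q := by exact_mod_cast hlt
          rw [abs_sub_comm]
          refine le_trans ?_ (le_abs_self _)
          nlinarith
      rw [this, sub_self, zero_div, mul_zero]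
    have e : 2 ^ (I + 1) = 2 ^ I + 2 ^ I := by rw [pow_succ, mul_two]
    rw [e, Finset.sum_range_add, hstep, ih, nodeTerm_eq hp, nodeM_eq hp,
      nodeH_eq hp, truncDist_sub_eq_second_difference hh.le, hw]
    rw [hw] at hy1 hy2
    clear ih hstep
    generalize hheq : (1 / 2 : ℝ) ^ (I + 1) = h at *
    have e1 : (2 * (p : ℝ) + 1) * h - h = p * (2 * h) := by ring
    have e2 : (2 * (p : ℝ) + 1) * h + h = (p + 1) * (2 * h) := by ring
    rw [e1, e2]
    have htent : h - truncDist ((2 * p + 1) * h) h y = h - |y - (2 * p + 1) * h| := by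
      rw [truncDist, min_eq_right]
      rw [abs_le]; constructor <;> linarith
    rw [htent]
    -- The new hat breaks the old chord at the midpoint; y selects the half on which the finer chord
    -- is read off.
    rcases le_total y ((2 * p + 1) * h) with hym | hym
    · refine ⟨2 * p, by omega, by push_cast; linarith, by push_cast; linarith, ?_⟩
      rw [abs_of_nonpos (sub_nonpos.2 hym)]
      push_cast
      have e3 : 2 * (p : ℝ) * h = p * (2 * h) := by ring
      rw [e3]
      field_simp
      ring
    · refine ⟨2 * p + 1, by omega, by push_cast; linarith, by push_cast; linarith, ?_⟩
      rw [abs_of_nonneg (sub_nonneg.2 hym)]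
      push_cast
      have e3 : (2 * (p : ℝ) + 1 + 1) * h = (p + 1) * (2 * h) := by ring
      rw [e3]
      field_simp
      ring

/-- The interpolant is a convex combination of values at grid points within one grid width of y, and
the distance is 1-Lipschitz. -/
theorem abs_sum_nodeTerm_sub_le {x y : ℝ} (hx : x ∈ Set.Icc (0 : ℝ) 1)
    (hy : y ∈ Set.Icc (0 : ℝ) 1) (I : ℕ) :
    abs (∑ v ∈ Finset.range (2 ^ I), nodeTerm v (truncDist (nodeM v) (nodeH v) x) y - |x - y|) ≤
      (1 / 2) ^ I := by
  obtain ⟨p, -, h1, h2, h⟩ := exists_sum_nodeTerm_eq_interpolation hx hy I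
  rw [h]
  have hw : 0 < (1 / 2 : ℝ) ^ I := by positivity
  generalize (1 / 2 : ℝ) ^ I = w at *
  have a1 : |(|x - p * w| - |x - y|)| ≤ w := by
    refine (abs_abs_sub_abs_le _ _).trans ?_
    rw [abs_le]; constructor <;> linarith
  have a2 : |(|x - (p + 1) * w| - |x - y|)| ≤ w := by
    refine (abs_abs_sub_abs_le _ _).trans ?_
    rw [abs_le]; constructor <;> linarith
  rw [abs_le] at a1 a2 ⊢
  rw [le_sub_iff_add_le, sub_le_iff_le_add, le_div_iff₀ hw, div_le_iff₀ hw]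
  constructor <;> nlinarith

theorem nodeTerm_add (v : ℕ) (s z y : ℝ) : nodeTerm v (s + z) y =
    nodeTerm v s y + z * (1 - nodeG v * truncDist (nodeM v) (nodeH v) y) := by
  unfold nodeTerm; ring

/-! ### Balancing noise against sensitivity over the levels -/

theorem sum_pow_le_inv_one_sub {r : ℝ} (h0 : 0 ≤ r) (h1 : r < 1) (I : ℕ) :
    ∑ i ∈ Finset.range I, r ^ i ≤ (1 - r)⁻¹ := by
  rw [← tsum_geometric_of_lt_one h0 h1]
  exact (summable_geometric_of_lt_one h0 h1).sum_le_tsum _ fun _ _ => by positivity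

/-- Total effect of noise of size `nodeB v` at every node `v`. -/
theorem sum_nodeB_mul_le {y : ℝ} (hy : y ∈ Set.Icc (0 : ℝ) 1) (I : ℕ) :
    ∑ v ∈ Finset.range (2 ^ I), nodeB v * |1 - nodeG v * truncDist (nodeM v) (nodeH v) y| ≤ 5 := by
  rw [sum_range_two_pow]
  have h0 : nodeB 0 * |1 - nodeG 0 * truncDist (nodeM 0) (nodeH 0) y| ≤ 1 := by
    simp only [nodeB, nodeG, nodeM, nodeH, truncDist, if_true, sub_zero, abs_of_nonneg hy.1,
      min_eq_right hy.2, one_mul]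
    rw [abs_le]; constructor <;> linarith [hy.1, hy.2]
  have h1 : ∀ i ∈ Finset.range I, ∑ p ∈ Finset.range (2 ^ i), nodeB (2 ^ i + p) *
      |1 - nodeG (2 ^ i + p) * truncDist (nodeM (2 ^ i + p)) (nodeH (2 ^ i + p)) y| ≤
      (3 / 4) ^ i := by
    intro i _
    have hh : 0 < (1 / 2 : ℝ) ^ (i + 1) := by positivity
    have : ∀ p ∈ Finset.range (2 ^ i), nodeB (2 ^ i + p) *
        |1 - nodeG (2 ^ i + p) * truncDist (nodeM (2 ^ i + p)) (nodeH (2 ^ i + p)) y| =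
        (3 / 4) ^ i / (1 / 2) ^ (i + 1) *
          ((1 / 2) ^ (i + 1) - truncDist ((2 * p + 1) * (1 / 2) ^ (i + 1)) ((1 / 2) ^ (i + 1)) y) := by
      intro p hp
      rw [Finset.mem_range] at hp
      rw [nodeB_eq hp, nodeG_eq hp, nodeM_eq hp, nodeH_eq hp]
      generalize (1 / 2 : ℝ) ^ (i + 1) = h at *
      have ht := truncDist_le ((2 * p + 1) * h) h y
      rw [abs_of_nonneg]
      · field_simp
      · rw [one_div_mul_eq_div, sub_nonneg, div_le_one hh]; exact ht
    rw [Finset.sum_congr rfl this, ← Finset.mul_sum]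
    have := (sum_tents_le hh.le y (2 ^ i)).1
    calc _ ≤ (3 / 4 : ℝ) ^ i / (1 / 2) ^ (i + 1) * (1 / 2) ^ (i + 1) := by gcongr
      _ = _ := by field_simp
  -- The root costs 1 and the levels cost at most 1/(1 - 3/4) = 4.
  have h2 := sum_pow_le_inv_one_sub (r := 3 / 4) (by norm_num) (by norm_num) I
  norm_num at h2
  linarith [Finset.sum_le_sum h1]

/-- Total sensitivity of the node statistics to one point, in units of the noise. -/
theorem sum_abs_truncDist_sub_div_nodeB_le {x x' : ℝ} (hx : x ∈ Set.Icc (0 : ℝ) 1)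
    (hx' : x' ∈ Set.Icc (0 : ℝ) 1) (I : ℕ) :
    ∑ v ∈ Finset.range (2 ^ I),
      |truncDist (nodeM v) (nodeH v) x - truncDist (nodeM v) (nodeH v) x'| / nodeB v ≤ 4 := by
  rw [sum_range_two_pow]
  have h0 : |truncDist (nodeM 0) (nodeH 0) x - truncDist (nodeM 0) (nodeH 0) x'| / nodeB 0 ≤ 1 := by
    rw [nodeB, if_pos rfl, div_one]
    refine (abs_truncDist_sub_le _ _ _ _).trans ?_
    rw [abs_le]; constructor <;> linarith [hx.1, hx.2, hx'.1, hx'.2]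
  have h1 : ∀ i ∈ Finset.range I, ∑ p ∈ Finset.range (2 ^ i),
      |truncDist (nodeM (2 ^ i + p)) (nodeH (2 ^ i + p)) x -
        truncDist (nodeM (2 ^ i + p)) (nodeH (2 ^ i + p)) x'| / nodeB (2 ^ i + p) ≤ (2 / 3) ^ i := by
    intro i _
    -- On one level the tents at x and at x' each sum to at most one half-width. In units of (3/4)^i
    -- this gives (2/3)^i, so the levels cost at most 3 beyond the root.
    have hpow : (2 / 3 : ℝ) ^ i = ((1 / 2) ^ (i + 1) + (1 / 2) ^ (i + 1)) / (3 / 4) ^ i := by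
      rw [pow_succ, ← mul_add, add_halves, mul_one, ← div_pow]; norm_num
    have hh : 0 < (1 / 2 : ℝ) ^ (i + 1) := by positivity
    rw [hpow]
    have hterm : ∀ p ∈ Finset.range (2 ^ i),
        |truncDist (nodeM (2 ^ i + p)) (nodeH (2 ^ i + p)) x -
          truncDist (nodeM (2 ^ i + p)) (nodeH (2 ^ i + p)) x'| / nodeB (2 ^ i + p) ≤
        (((1 / 2) ^ (i + 1) - truncDist ((2 * p + 1) * (1 / 2) ^ (i + 1)) ((1 / 2) ^ (i + 1)) x) +
          ((1 / 2) ^ (i + 1) - truncDist ((2 * p + 1) * (1 / 2) ^ (i + 1)) ((1 / 2) ^ (i + 1)) x'))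
          / (3 / 4) ^ i := by
      intro p hp
      rw [Finset.mem_range] at hp
      rw [nodeB_eq hp, nodeM_eq hp, nodeH_eq hp]
      generalize (1 / 2 : ℝ) ^ (i + 1) = h at *
      gcongr
      have h1 := truncDist_le ((2 * p + 1) * h) h x
      have h2 := truncDist_le ((2 * p + 1) * h) h x'
      rw [abs_le]; constructor <;> linarith
    refine (Finset.sum_le_sum hterm).trans ?_
    rw [← Finset.sum_div, Finset.sum_add_distrib]
    gcongr
    · exact (sum_tents_le hh.le x (2 ^ i)).1
    · exact (sum_tents_le hh.le x' (2 ^ i)).1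
  have h2 := sum_pow_le_inv_one_sub (r := 2 / 3) (by norm_num) (by norm_num) I
  norm_num at h2
  linarith [Finset.sum_le_sum h1]

/-! ### Verifying programs -/

/-- Total correctness with a time bound: `p` started in `m` halts within `T` steps, in a memory
satisfying `Post`. -/
def Runs (ω : Tape) (p : Program) (T : ℕ) (m : State) (Post : State → Prop) : Prop :=
  ∃ m' t, Exec ω p m m' t ∧ t ≤ T ∧ Post m'

variable {ω : Tape}

theorem Runs.mono {p : Program} {T T' : ℕ} {m : State} {P P' : State → Prop}
    (h : Runs ω p T m P) (hT : T ≤ T') (hP : ∀ m', P m' → P' m') : Runs ω p T' m P' := by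
  obtain ⟨m', t, he, ht, hp⟩ := h
  exact ⟨m', t, he, ht.trans hT, hP _ hp⟩

theorem Exec.runs {p : Program} {m m' : State} {t : ℕ} {P : State → Prop}
    (h : Exec ω p m m' t) (hP : P m') : Runs ω p t m P :=
  ⟨m', t, h, le_rfl, hP⟩

theorem Runs.seq {p q : Program} {T T' : ℕ} {m : State} {P P' : State → Prop}
    (h : Runs ω p T m P) (h' : ∀ m', P m' → Runs ω q T' m' P') :
    Runs ω (.seq p q) (T + T') m P' := by
  obtain ⟨m', t, he, ht, hp⟩ := h
  obtain ⟨m'', t', he', ht', hp'⟩ := h' m' hp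
  exact ⟨m'', t + t', .seq he he', by omega, hp'⟩

theorem Runs.ite {b : Test} {p q : Program} {T : ℕ} {m : State} {P : State → Prop}
    (h : b.Holds m → Runs ω p T m P) (h' : ¬ b.Holds m → Runs ω q T m P) :
    Runs ω (.ite b p q) (T + 1) m P := by
  by_cases hb : b.Holds m
  · obtain ⟨m', t, he, ht, hp⟩ := h hb
    exact ⟨m', t + 1, .iteTrue hb he, by omega, hp⟩
  · obtain ⟨m', t, he, ht, hp⟩ := h' hb
    exact ⟨m', t + 1, .iteFalse hb he, by omega, hp⟩

/-- Indexing the invariant by the number of rounds proves termination and the time bound together;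
the last step is the failing test. -/
theorem Runs.while {b : Test} {p : Program} {N T : ℕ} (inv : ℕ → State → Prop)
    (hstep : ∀ k < N, ∀ m, inv k m → b.Holds m ∧ Runs ω p T m (inv (k + 1)))
    (hend : ∀ m, inv N m → ¬ b.Holds m) {m : State} (h0 : inv 0 m) :
    Runs ω (.while b p) (N * (T + 1) + 1) m (inv N) := by
  suffices H : ∀ d k, k + d = N → ∀ m, inv k m →
      Runs ω (.while b p) (d * (T + 1) + 1) m (inv N) from H N 0 (by simp) m h0
  intro d
  induction d with
  | zero =>
    rintro k hk m hm
    obtain rfl : k = N := by omega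
    exact ⟨m, 1, .whileFalse (hend m hm), by omega, hm⟩
  | succ d ih =>
    intro k hk m hm
    obtain ⟨hb, m', t, he, ht, hm'⟩ := hstep k (by omega) m hm
    obtain ⟨m'', t', he', ht', hp⟩ := ih (k + 1) (by omega) m' hm'
    refine ⟨m'', t + t' + 1, .whileTrue hb he he', ?_, hp⟩
    rw [add_mul]; omega

/-- A sequence of primitive instructions. -/
def line (l : List Instr) : Program := l.foldr (fun i p => .seq (.instr i) p) (.instr .skip)

theorem exec_line (l : List Instr) (m : State) :
    Exec ω (line l) m (l.foldl (fun m i => i.apply ω m) m) (l.length + 1) := by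
  induction l generalizing m with
  | nil => exact Exec.instr _ _
  | cons i l ih =>
    have := Exec.seq (Exec.instr (ω := ω) i m) (ih (i.apply ω m))
    rwa [add_comm 1] at this

theorem runs_line {l : List Instr} {m : State} {P : State → Prop}
    (h : P (l.foldl (fun m i => i.apply ω m) m)) : Runs ω (line l) (l.length + 1) m P :=
  (exec_line l m).runs h

/-- `reg r := |reg r|`, given that `reg 3 = 0`. -/
def absCode (r : ℕ) : Program := .ite (.regLe 3 r) (.instr .skip) (.instr (.sub r 3 r))

theorem exec_absCode (r : ℕ) {m : State} (h : m.reg 3 = 0) :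
    Exec ω (absCode r) m { m with reg := Function.update m.reg r |m.reg r| } 2 := by
  by_cases hb : (Test.regLe 3 r).Holds m
  · have h0 : 0 ≤ m.reg r := by simpa [Test.Holds, h] using hb
    have : ({ m with reg := Function.update m.reg r |m.reg r| } : State) = Instr.skip.apply ω m := by
      rw [abs_of_nonneg h0, Function.update_eq_self]; rfl
    rw [this]
    exact .iteTrue hb (.instr _ _)
  · have h0 : m.reg r ≤ 0 := by
      have : ¬ (0 ≤ m.reg r) := by simpa [Test.Holds, h] using hb
      linarith
    have : ({ m with reg := Function.update m.reg r |m.reg r| } : State) =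
        (Instr.sub r 3 r).apply ω m := by
      rw [abs_of_nonpos h0, Instr.apply, h, zero_sub]
    rw [this]
    exact .iteFalse hb (.instr _ _)

/-- `reg r := min (reg s) (reg r)`, given that `reg 3 = 0`. -/
def minCode (r s : ℕ) : Program := .ite (.regLe r s) (.instr .skip) (.instr (.add r s 3))

theorem exec_minCode (r s : ℕ) {m : State} (h : m.reg 3 = 0) :
    Exec ω (minCode r s) m { m with reg := Function.update m.reg r (min (m.reg s) (m.reg r)) } 2 := by
  by_cases hb : (Test.regLe r s).Holds m
  · have : ({ m with reg := Function.update m.reg r (min (m.reg s) (m.reg r)) } : State) =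
        Instr.skip.apply ω m := by
      rw [min_eq_right hb, Function.update_eq_self]; rfl
    rw [this]
    exact .iteTrue hb (.instr _ _)
  · have : ({ m with reg := Function.update m.reg r (min (m.reg s) (m.reg r)) } : State) =
        (Instr.add r s 3).apply ω m := by
      rw [min_eq_left (not_le.1 hb).le, Instr.apply, h, add_zero]
    rw [this]
    exact .iteFalse hb (.instr _ _)

/-! ### The query program -/

def queryBody : Program :=
  .seq (line [.load 1 0 2, .idxAdd 2 2 4, .load 5 0 2, .idxAdd 2 2 4, .load 6 0 2, .idxAdd 2 2 4,
    .load 7 0 2, .idxAdd 2 2 4, .load 8 1 3, .sub 8 8 5]) <|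
  .seq (absCode 8) <| .seq (minCode 8 6) <|
  .seq (line [.mul 8 1 8, .add 8 8 7, .add 0 0 8, .idxAdd 3 3 4])
    (.ite (.idxLt 3 1) (.instr .skip) (.instr (.idxConst 3 0)))

/-- The query program: every record `(c, m, h, d)` contributes `c * truncDist m h y + d`, where `y`
is the coordinate of the query point that the record belongs to. -/
def queryProgram : Program := .seq (line [.idxConst 4 1]) (.while (.idxLt 2 0) queryBody)

/-- Coordinate `i` of a point. -/
def coord {ℓ : ℕ} (y : Point ℓ) (i : ℕ) : ℝ := if h : i < ℓ then y ⟨i, h⟩ else 0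

/-- Entry `i` of a data structure. -/
def DataStructure.entry (S : DataStructure) (i : ℕ) : ℝ := if h : i < S.1 then S.2 ⟨i, h⟩ else 0

/-- The number computed by the query program from `N` records. -/
def estimate {ℓ : ℕ} (N : ℕ) (S : DataStructure) (y : Point ℓ) : ℝ :=
  ∑ k ∈ Finset.range N, (S.entry (4 * k) *
    truncDist (S.entry (4 * k + 1)) (S.entry (4 * k + 2)) (coord y (k % ℓ)) + S.entry (4 * k + 3))

structure QueryInv {ℓ : ℕ} (N : ℕ) (S : DataStructure) (y : Point ℓ) (k : ℕ) (m : State) : Prop where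
  idx0 : m.idx 0 = 4 * N
  idx1 : m.idx 1 = ℓ
  idx2 : m.idx 2 = 4 * k
  idx3 : m.idx 3 = k % ℓ
  idx4 : m.idx 4 = 1
  reg0 : m.reg 0 = estimate k S y
  reg3 : m.reg 3 = 0
  arr0 : ∀ i, m.arr 0 i = S.entry i
  arr1 : ∀ i, m.arr 1 i = coord y i

/-- The machine cannot divide indices, so `k % ℓ` is kept in `idx 3` as a counter that wraps at ℓ.
This fixes the order of the records: the coordinate runs fastest. -/
theorem answers_queryProgram {ℓ : ℕ} (hℓ : 1 ≤ ℓ) (N : ℕ) (S : DataStructure) (hS : S.1 = 4 * N)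
    (y : Point ℓ) : ∃ t, Answers queryProgram S y (estimate N S y) t ∧ t ≤ 26 * N + 3 := by
  have main : Runs (fun _ => 0) queryProgram (26 * N + 3) (queryInput S y) (QueryInv N S y N) := by
    refine ((runs_line (P := QueryInv N S y 0) ?_).seq fun m hm =>
      Runs.while (N := N) (T := 24) (QueryInv N S y) ?_ ?_ hm).mono
      (by simp only [List.length]; omega) fun _ h => h
    · simp only [List.foldl, Instr.apply, queryInput]
      constructor <;> simp [hS, estimate, DataStructure.entry, coord]
    · intro k hk m hm
      refine ⟨by simp only [Test.Holds, hm.idx0, hm.idx2]; omega, ?_⟩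
      have step : Runs (fun _ => 0) queryBody (11 + (2 + (2 + (5 + 2)))) m (QueryInv N S y (k + 1)) := by
        refine (runs_line rfl).seq ?_
        rintro m1 rfl
        refine ((exec_absCode 8 ?_).runs rfl).seq ?_
        · simp [Instr.apply, hm.reg3]
        rintro m2 rfl
        refine ((exec_minCode 8 6 ?_).runs rfl).seq ?_
        · simp [Instr.apply, hm.reg3]
        rintro m3 rfl
        refine (runs_line rfl).seq ?_
        rintro m4 rfl
        refine Runs.ite (fun hb => ?_) (fun hb => ?_)
        · refine (Exec.instr _ _).runs ?_
          simp [Test.Holds, Instr.apply, hm.idx1, hm.idx3, hm.idx4] at hb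
          constructor <;> simp [Instr.apply, hm.idx0, hm.idx1, hm.idx2, hm.idx3, hm.idx4, hm.reg0,
            hm.reg3, hm.arr0, hm.arr1, estimate, Finset.sum_range_succ, truncDist]
          · ring
          · rw [Nat.add_mod, Nat.mod_eq_of_lt (a := 1) (by omega), Nat.mod_eq_of_lt hb]
        · refine (Exec.instr _ _).runs ?_
          simp [Test.Holds, Instr.apply, hm.idx1, hm.idx3, hm.idx4] at hb
          constructor <;> simp [Instr.apply, hm.idx0, hm.idx1, hm.idx2, hm.idx3, hm.idx4, hm.reg0,
            hm.reg3, hm.arr0, hm.arr1, estimate, Finset.sum_range_succ, truncDist]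
          · ring
          · have := Nat.mod_lt k (show ℓ > 0 by omega)
            refine (Nat.mod_eq_zero_of_dvd ?_).symm
            rw [show k + 1 = ℓ * (k / ℓ) + (k % ℓ + 1) by have := Nat.div_add_mod k ℓ; omega,
              show k % ℓ + 1 = ℓ by omega]
            exact ⟨k / ℓ + 1, by ring⟩
      exact step.mono (by norm_num) fun _ h => h
    · intro m hm
      simp [Test.Holds, hm.idx0, hm.idx2]
  obtain ⟨m, t, he, ht, hm⟩ := main
  exact ⟨t, ⟨m, he, hm.reg0⟩, ht⟩

/-! ### The release program -/

/-- Add to `reg 11` a logistic variable scaled by `reg 6`, given that `reg 14 = 1`. -/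
def noiseCode : List Instr :=
  [.rand 12, .sub 13 14 12, .div 12 12 13, .log 12 12, .mul 12 12 6, .add 11 11 12]

def pointBody : Program :=
  .seq (line [.load 12 0 4, .sub 12 12 7]) <|
  .seq (absCode 12) <| .seq (minCode 12 8) <|
  line [.add 11 11 12, .idxAdd 4 4 1, .idxAdd 2 2 6]

/-- `idx 4` visits one coordinate of all points in strides of ℓ. With noisy average s the record
written is `(1 - s * g, m, h, s - e)`, matching `nodeTerm`. -/
def coordBody : Program :=
  .seq (line [.idxAdd 4 3 7, .idxConst 2 0, .const 11 0]) <|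
  .seq (.while (.idxLt 2 0) pointBody) <|
  .seq (line [.div 11 11 4]) <|
  .seq (line noiseCode) <|
  line [.mul 12 11 9, .sub 12 14 12, .store 1 5 12, .idxAdd 5 5 6, .store 1 5 7, .idxAdd 5 5 6,
    .store 1 5 8, .idxAdd 5 5 6, .sub 12 11 10, .store 1 5 12, .idxAdd 5 5 6, .idxAdd 3 3 6]

/-- Write the records of one node. -/
def nodeCode : Program :=
  .seq (line [.idxConst 3 0]) (.while (.idxLt 3 1) coordBody)

/-- The registers that are constant during the main loops. -/
structure ConstRegs (n ℓ : ℕ) (X : ℕ → ℝ) (u : ℝ) (m : State) : Prop where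
  idx0 : m.idx 0 = n
  idx1 : m.idx 1 = ℓ
  idx6 : m.idx 6 = 1
  idx7 : m.idx 7 = 0
  reg3 : m.reg 3 = 0
  reg4 : m.reg 4 = n
  reg5 : m.reg 5 = u
  reg14 : m.reg 14 = 1
  reg16 : m.reg 16 = 1 / 2
  reg17 : m.reg 17 = 3 / 4
  arr0 : m.arr 0 = X

/-- The first `k` records have been written, and `k` random numbers have been used. -/
structure Written (out : ℕ → ℕ → ℝ) (k : ℕ) (m : State) : Prop where
  idx5 : m.idx 5 = 4 * k
  pos : m.pos = k
  arr1 : ∀ k' < k, ∀ c < 4, m.arr 1 (4 * k' + c) = out k' c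

/-- The registers describing the node `v`. -/
structure NodeRegs (b : ℝ) (v : ℕ) (m : State) : Prop where
  reg6 : m.reg 6 = b * nodeB v
  reg7 : m.reg 7 = nodeM v
  reg8 : m.reg 8 = nodeH v
  reg9 : m.reg 9 = nodeG v
  reg10 : m.reg 10 = nodeE v

/-- Statistic of node `v` in coordinate `i`, for `n` points with coordinates listed in `X`. -/
def stat (n ℓ : ℕ) (X : ℕ → ℝ) (v i : ℕ) : ℝ :=
  (∑ j ∈ Finset.range n, truncDist (nodeM v) (nodeH v) (X (j * ℓ + i))) / n

def treeConst (ℓ k c : ℕ) : ℝ :=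
  if c = 0 then 1 else if c = 1 then nodeM (k / ℓ) else if c = 2 then nodeH (k / ℓ)
  else -nodeE (k / ℓ)

def treeSlope (ℓ k c : ℕ) : ℝ :=
  if c = 0 then -nodeG (k / ℓ) else if c = 1 then 0 else if c = 2 then 0 else 1

/-- The noisy statistics. -/
def treeStat (n ℓ : ℕ) (X : ℕ → ℝ) (b : ℝ) (ω : Tape) (k : ℕ) : ℝ :=
  stat n ℓ X (k / ℓ) (k % ℓ) + logistic (ω k) * (b * nodeB (k / ℓ))

def treeOut (n ℓ : ℕ) (X : ℕ → ℝ) (b : ℝ) (ω : Tape) (k c : ℕ) : ℝ :=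
  treeConst ℓ k c + treeSlope ℓ k c * treeStat n ℓ X b ω k

/-! ### Correctness and running time of the tree release -/

theorem runs_pointLoop {n ℓ : ℕ} {X : ℕ → ℝ} {u b w : ℝ} {v k i : ℕ} {out : ℕ → ℕ → ℝ} {m : State}
    (hc : ConstRegs n ℓ X u m) (hn : NodeRegs b v m) (hw : Written out k m) (h3 : m.idx 3 = i)
    (h4 : m.idx 4 = i) (h2 : m.idx 2 = 0) (h11 : m.reg 11 = 0) (h15 : m.reg 15 = w) :
    Runs ω (.while (.idxLt 2 0) pointBody) (n * 12 + 1) m fun m' =>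
      ConstRegs n ℓ X u m' ∧ NodeRegs b v m' ∧ Written out k m' ∧ m'.idx 3 = i ∧ m'.reg 15 = w ∧
        m'.reg 11 = ∑ j ∈ Finset.range n, truncDist (nodeM v) (nodeH v) (X (j * ℓ + i)) := by
  refine (Runs.while (N := n) (T := 11) (fun j m' => (ConstRegs n ℓ X u m' ∧ NodeRegs b v m' ∧
      Written out k m' ∧ m'.idx 3 = i ∧ m'.reg 15 = w ∧
      m'.reg 11 = ∑ j ∈ Finset.range j, truncDist (nodeM v) (nodeH v) (X (j * ℓ + i))) ∧
      m'.idx 2 = j ∧ m'.idx 4 = j * ℓ + i) ?_ ?_ ?_).mono le_rfl fun _ h => h.1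
  · rintro j hj m ⟨⟨hc, hn, hw, h3, h15, h11⟩, h2, h4⟩
    refine ⟨by simpa [Test.Holds, hc.idx0, h2] using hj, ?_⟩
    have step : Runs ω pointBody (3 + (2 + (2 + 4))) m fun m' => (ConstRegs n ℓ X u m' ∧
        NodeRegs b v m' ∧ Written out k m' ∧ m'.idx 3 = i ∧ m'.reg 15 = w ∧
        m'.reg 11 = ∑ j ∈ Finset.range (j + 1), truncDist (nodeM v) (nodeH v) (X (j * ℓ + i))) ∧
        m'.idx 2 = j + 1 ∧ m'.idx 4 = (j + 1) * ℓ + i := by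
      refine (runs_line rfl).seq ?_
      rintro m1 rfl
      refine ((exec_absCode 12 ?_).runs rfl).seq ?_
      · simp [Instr.apply, hc.reg3]
      rintro m2 rfl
      refine ((exec_minCode 12 8 ?_).runs rfl).seq ?_
      · simp [Instr.apply, hc.reg3]
      rintro m3 rfl
      refine runs_line ⟨⟨?_, ?_, ?_, ?_, ?_, ?_⟩, ?_, ?_⟩
      · constructor <;> simp [Instr.apply, hc.idx0, hc.idx1, hc.idx6, hc.idx7, hc.reg3, hc.reg4,
          hc.reg5, hc.reg14, hc.reg16, hc.reg17, hc.arr0]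
      · constructor <;> simp [Instr.apply, hn.reg6, hn.reg7, hn.reg8, hn.reg9, hn.reg10]
      · constructor
        · simp [Instr.apply, hw.idx5]
        · simp [Instr.apply, hw.pos]
        · simpa [Instr.apply] using hw.arr1
      · simp [Instr.apply, h3]
      · simp [Instr.apply, h15]
      · simp [Instr.apply, h11, Finset.sum_range_succ, truncDist, hn.reg7, hn.reg8, hc.arr0, h4]
      · simp [Instr.apply, h2, hc.idx6]
      · simp [Instr.apply, h4, hc.idx1]; ring
    exact step.mono (by norm_num) fun _ h => h
  · rintro m ⟨⟨hc, -⟩, h2, -⟩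
    simp [Test.Holds, hc.idx0, h2]
  · exact ⟨⟨hc, hn, hw, h3, h15, by simpa using h11⟩, h2, by simpa using h4⟩

theorem runs_coordBody {n ℓ : ℕ} {X : ℕ → ℝ} {u b w : ℝ} {v i : ℕ} {m : State} (hi : i < ℓ)
    (hc : ConstRegs n ℓ X u m) (hn : NodeRegs b v m)
    (hw : Written (treeOut n ℓ X b ω) (v * ℓ + i) m) (h3 : m.idx 3 = i) (h15 : m.reg 15 = w) :
    Runs ω coordBody (n * 12 + 27) m fun m' => ConstRegs n ℓ X u m' ∧ NodeRegs b v m' ∧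
      Written (treeOut n ℓ X b ω) (v * ℓ + i + 1) m' ∧ m'.idx 3 = i + 1 ∧ m'.reg 15 = w := by
  have step : Runs ω coordBody (4 + ((n * 12 + 1) + (2 + (7 + 13)))) m fun m' =>
      ConstRegs n ℓ X u m' ∧ NodeRegs b v m' ∧
      Written (treeOut n ℓ X b ω) (v * ℓ + i + 1) m' ∧ m'.idx 3 = i + 1 ∧ m'.reg 15 = w := by
    refine (runs_line rfl).seq ?_
    rintro m1 rfl
    refine (runs_pointLoop (n := n) (ℓ := ℓ) (X := X) (u := u) (b := b) (v := v) (i := i) (w := w)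
      (k := v * ℓ + i) (out := treeOut n ℓ X b ω) ?_ ?_ ?_ ?_ ?_ ?_ ?_ ?_).seq ?_
    · constructor <;> simp [Instr.apply, hc.idx0, hc.idx1, hc.idx6, hc.idx7, hc.reg3, hc.reg4,
        hc.reg5, hc.reg14, hc.reg16, hc.reg17, hc.arr0]
    · constructor <;> simp [Instr.apply, hn.reg6, hn.reg7, hn.reg8, hn.reg9, hn.reg10]
    · constructor
      · simp [Instr.apply, hw.idx5]
      · simp [Instr.apply, hw.pos]
      · simpa [Instr.apply] using hw.arr1
    · simp [Instr.apply, h3]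
    · simp [Instr.apply, h3, hc.idx7]
    · simp [Instr.apply]
    · simp [Instr.apply]
    · simp [Instr.apply, h15]
    clear hc hn hw h3 h15 m
    rintro m ⟨hc, hn, hw, h3, h15, h11⟩
    refine (runs_line rfl).seq ?_
    rintro m1 rfl
    refine (runs_line rfl).seq ?_
    rintro m2 rfl
    have hz : stat n ℓ X v i + logistic (ω (v * ℓ + i)) * (b * nodeB v) =
        treeStat n ℓ X b ω (v * ℓ + i) := by
      have h1 : (v * ℓ + i) / ℓ = v := by
        rw [mul_comm, Nat.mul_add_div (by omega), Nat.div_eq_of_lt hi, add_zero]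
      have h2 : (v * ℓ + i) % ℓ = i := by
        rw [mul_comm, Nat.mul_add_mod, Nat.mod_eq_of_lt hi]
      rw [treeStat, h1, h2]
    have hdiv : (v * ℓ + i) / ℓ = v := by
      rw [mul_comm, Nat.mul_add_div (by omega), Nat.div_eq_of_lt hi, add_zero]
    refine runs_line ⟨?_, ?_, ?_, ?_, ?_⟩
    · constructor <;> simp [noiseCode, Instr.apply, hc.idx0, hc.idx1, hc.idx6, hc.idx7, hc.reg3,
        hc.reg4, hc.reg5, hc.reg14, hc.reg16, hc.reg17, hc.arr0]
    · constructor <;> simp [noiseCode, Instr.apply, hn.reg6, hn.reg7, hn.reg8, hn.reg9, hn.reg10]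
    · constructor
      · simp [noiseCode, Instr.apply, hw.idx5, hc.idx6]; ring
      · simp [noiseCode, Instr.apply, hw.pos]
      · intro k' hk' c hc4
        rcases Nat.lt_succ_iff_lt_or_eq.1 hk' with hlt | rfl
        -- Earlier records survive because all four writes go to positions from `4 * (v * ℓ + i)`
        -- on.
        · rw [← hw.arr1 k' hlt c hc4]
          simp [noiseCode, Instr.apply, hw.idx5, hc.idx6, Function.update_apply]
          split_ifs <;> first | omega | rfl
        · have h4 : c = 0 ∨ c = 1 ∨ c = 2 ∨ c = 3 := by omega
          rcases h4 with rfl | rfl | rfl | rfl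
          · simp [noiseCode, Instr.apply, hw.idx5, hc.idx6, Function.update_apply, treeOut,
              treeConst, treeSlope, hdiv, ← hz, h11, stat, logistic, hn.reg6, hn.reg9, hc.reg4,
              hc.reg14, hw.pos]
            split_ifs <;> first | omega | ring
          · simp [noiseCode, Instr.apply, hw.idx5, hc.idx6, treeOut, treeConst, treeSlope, hdiv,
              hn.reg7]
          · simp [noiseCode, Instr.apply, hw.idx5, hc.idx6, treeOut, treeConst, treeSlope, hdiv,
              hn.reg8]
          · simp [noiseCode, Instr.apply, hw.idx5, hc.idx6, treeOut, treeConst, treeSlope, hdiv,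
              ← hz, h11, stat, logistic, hn.reg6, hn.reg10, hc.reg4, hc.reg14, hw.pos]
            ring
    · simp [noiseCode, Instr.apply, h3, hc.idx6]
    · simp [noiseCode, Instr.apply, h15]
  exact step.mono (by omega) fun _ h => h

theorem runs_nodeCode {n ℓ : ℕ} {X : ℕ → ℝ} {u b w : ℝ} {v : ℕ} {m : State}
    (hc : ConstRegs n ℓ X u m) (hn : NodeRegs b v m)
    (hw : Written (treeOut n ℓ X b ω) (v * ℓ) m) (h15 : m.reg 15 = w) :
    Runs ω nodeCode (ℓ * (n * 12 + 28) + 3) m fun m' => ConstRegs n ℓ X u m' ∧ NodeRegs b v m' ∧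
      Written (treeOut n ℓ X b ω) ((v + 1) * ℓ) m' ∧ m'.reg 15 = w := by
  refine ((runs_line rfl).seq fun m1 hm1 => ((Runs.while (N := ℓ) (T := n * 12 + 27)
    (fun i m' => ConstRegs n ℓ X u m' ∧ NodeRegs b v m' ∧
      Written (treeOut n ℓ X b ω) (v * ℓ + i) m' ∧ m'.idx 3 = i ∧ m'.reg 15 = w) ?_ ?_ ?_).mono
        le_rfl fun m' h => ⟨h.1, h.2.1, ?_, h.2.2.2.2⟩)).mono ?_ fun _ h => h
  · rintro i hi m ⟨hc, hn, hw, h3, h15⟩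
    exact ⟨by simpa [Test.Holds, h3, hc.idx1] using hi, runs_coordBody hi hc hn hw h3 h15⟩
  · rintro m ⟨hc, -, -, h3, -⟩
    simp [Test.Holds, h3, hc.idx1]
  · subst hm1
    refine ⟨?_, ?_, ⟨?_, ?_, ?_⟩, ?_, ?_⟩
    · constructor <;> simp [Instr.apply, hc.idx0, hc.idx1, hc.idx6, hc.idx7, hc.reg3,
        hc.reg4, hc.reg5, hc.reg14, hc.reg16, hc.reg17, hc.arr0]
    · constructor <;> simp [Instr.apply, hn.reg6, hn.reg7, hn.reg8, hn.reg9, hn.reg10]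
    · simp [Instr.apply, hw.idx5]
    · simp [Instr.apply, hw.pos]
    · simpa [Instr.apply] using hw.arr1
    · simp [Instr.apply]
    · simp [Instr.apply, h15]
  · change 2 + (ℓ * (n * 12 + 28) + 1) ≤ _
    omega
  · rw [add_mul, one_mul]; exact h.2.2.1

/-- Move on to the next node. -/
def advanceCode : Program :=
  .seq (line [.add 7 7 15])
    (.ite (.regLe 14 7) (line [.mul 15 15 16, .mul 8 8 16, .mul 6 6 17, .add 7 8 3, .add 10 8 3,
      .div 9 14 8]) (line []))

/-- A step of 2h to the right passes 1 exactly from the last interval of a level. Hence the program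
recognises the end of a level by one comparison, with no logarithm or rounding. -/
theorem node_succ (v : ℕ) (hv : 1 ≤ v) :
    (nodeM v + 2 * nodeH v < 1 ∧ nodeM (v + 1) = nodeM v + 2 * nodeH v ∧
      nodeH (v + 1) = nodeH v ∧ nodeB (v + 1) = nodeB v) ∨
    (1 ≤ nodeM v + 2 * nodeH v ∧ nodeM (v + 1) = nodeH v / 2 ∧
      nodeH (v + 1) = nodeH v / 2 ∧ nodeB (v + 1) = nodeB v * (3 / 4)) := by
  obtain ⟨i, p, hp, rfl⟩ : ∃ i p, p < 2 ^ i ∧ v = 2 ^ i + p := by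
    have h1 := Nat.pow_log_le_self 2 (x := v) (by omega)
    have h2 := Nat.lt_pow_succ_log_self (b := 2) (by norm_num) v
    rw [pow_succ] at h2
    exact ⟨Nat.log 2 v, v - 2 ^ Nat.log 2 v, by omega, by omega⟩
  have hone : (2 : ℝ) ^ i * (1 / 2) ^ (i + 1) = 1 / 2 := by
    rw [pow_succ, ← mul_assoc, ← mul_pow]; norm_num
  have hh : 0 < (1 / 2 : ℝ) ^ (i + 1) := by positivity
  rw [nodeM_eq hp, nodeH_eq hp, nodeB_eq hp]
  rcases (Nat.succ_le_of_lt hp).lt_or_eq with h | h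
  · left
    rw [add_assoc, nodeM_eq h, nodeH_eq h, nodeB_eq h]
    have : (p : ℝ) + 2 ≤ 2 ^ i := by exact_mod_cast h
    refine ⟨by nlinarith, by push_cast; ring, rfl, rfl⟩
  · right
    have hz : 0 < 2 ^ (i + 1) := by positivity
    have e : 2 ^ i + p + 1 = 2 ^ (i + 1) + 0 := by rw [pow_succ]; omega
    rw [e, nodeM_eq hz, nodeH_eq hz, nodeB_eq hz]
    have : (p : ℝ) + 1 = 2 ^ i := by exact_mod_cast h
    refine ⟨by nlinarith, by push_cast; ring, by ring, by ring⟩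

theorem runs_advanceCode {n ℓ : ℕ} {X : ℕ → ℝ} {u b : ℝ} {v k : ℕ} {out : ℕ → ℕ → ℝ} {m : State}
    (hv : 1 ≤ v) (hc : ConstRegs n ℓ X u m) (hn : NodeRegs b v m)
    (hw : Written out k m) (h15 : m.reg 15 = 2 * nodeH v) :
    Runs ω advanceCode 10 m fun m' => ConstRegs n ℓ X u m' ∧ NodeRegs b (v + 1) m' ∧
      Written out k m' ∧ m'.reg 15 = 2 * nodeH (v + 1) := by
  have hv0 : v ≠ 0 := by omega
  refine ((runs_line rfl).seq (T' := 8) fun m1 hm1 =>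
    Runs.ite (T := 7) (fun hb => ?_) (fun hb => ?_)).mono le_rfl fun _ h => h
  all_goals
    subst hm1
    simp [Test.Holds, Instr.apply, hc.reg14, hn.reg7, h15] at hb
  · rcases node_succ v hv with ⟨h, -⟩ | ⟨-, hM, hH, hB⟩
    · linarith
    refine runs_line ⟨?_, ?_, ⟨?_, ?_, ?_⟩, ?_⟩
    · constructor <;> simp [Instr.apply, hc.idx0, hc.idx1, hc.idx6, hc.idx7, hc.reg3,
        hc.reg4, hc.reg5, hc.reg14, hc.reg16, hc.reg17, hc.arr0]
    · constructor <;> simp [Instr.apply, hn.reg6, hn.reg8, hc.reg3, hc.reg14, hc.reg16, hc.reg17,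
        hM, hH, hB, nodeG, nodeE, hv0] <;> ring
    · simp [Instr.apply, hw.idx5]
    · simp [Instr.apply, hw.pos]
    · simpa [Instr.apply] using hw.arr1
    · simp [Instr.apply, h15, hc.reg16, hH]; ring
  · rcases node_succ v hv with ⟨-, hM, hH, hB⟩ | ⟨h, -⟩
    swap
    · linarith
    refine (runs_line ⟨?_, ?_, ⟨?_, ?_, ?_⟩, ?_⟩).mono (by simp) fun _ h => h
    · constructor <;> simp [Instr.apply, hc.idx0, hc.idx1, hc.idx6, hc.idx7, hc.reg3,
        hc.reg4, hc.reg5, hc.reg14, hc.reg16, hc.reg17, hc.arr0]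
    · constructor <;> simp [Instr.apply, hn.reg6, hn.reg7, hn.reg8, hn.reg9, hn.reg10, h15,
        hM, hH, hB, nodeG, nodeE, hv0]
    · simp [Instr.apply, hw.idx5]
    · simp [Instr.apply, hw.pos]
    · simpa [Instr.apply] using hw.arr1
    · simp [Instr.apply, h15, hH]

/-- Release noisy statistics of all nodes of length at least `reg 5`. -/
def treeCode : Program :=
  .seq (line [.const 6 4, .cast 12 1, .mul 6 6 12, .mul 12 4 0, .div 6 6 12, .const 7 0,
    .const 8 1, .const 9 2, .const 10 0]) <|
  .seq nodeCode <|
  .seq (line [.const 7 (1 / 2), .const 8 (1 / 2), .const 10 (1 / 2), .const 15 1]) <|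
  .seq (.while (.regLe 5 15) (.seq nodeCode advanceCode)) <|
  line [.idxAdd 0 5 7]

theorem runs_treeCode {n ℓ I : ℕ} (hn : 1 ≤ n) (hℓ : 1 ≤ ℓ) {X : ℕ → ℝ} {u ε : ℝ} {m : State}
    (hu1 : (1 / 2) ^ (I + 1) < u) (hu2 : u ≤ (1 / 2) ^ I) (hc : ConstRegs n ℓ X u m)
    (hw : Written (treeOut n ℓ X (4 * ℓ / (n * ε)) ω) 0 m) (h0 : m.reg 0 = ε) :
    Runs ω treeCode (100 * (n * ℓ) * 2 ^ (I + 1)) m fun m' => m'.idx 0 = 4 * (2 ^ (I + 1) * ℓ) ∧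
      Written (treeOut n ℓ X (4 * ℓ / (n * ε)) ω) (2 ^ (I + 1) * ℓ) m' := by
  set b : ℝ := 4 * ℓ / (n * ε) with hb
  have hpos : 1 ≤ 2 ^ (I + 1) := Nat.one_le_two_pow
  have main : Runs ω treeCode (10 + ((ℓ * (n * 12 + 28) + 3) + (5 + (((2 ^ (I + 1) - 1) *
      ((ℓ * (n * 12 + 28) + 3) + 10 + 1) + 1) + 2)))) m fun m' =>
      m'.idx 0 = 4 * (2 ^ (I + 1) * ℓ) ∧ Written (treeOut n ℓ X b ω) (2 ^ (I + 1) * ℓ) m' := by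
    refine (runs_line rfl).seq ?_
    rintro m1 rfl
    refine (runs_nodeCode (n := n) (ℓ := ℓ) (X := X) (u := u) (b := b) (v := 0) ?_ ?_
      (hw := ⟨?_, ?_, ?_⟩) rfl).seq ?_
    · constructor <;> simp [Instr.apply, hc.idx0, hc.idx1, hc.idx6, hc.idx7, hc.reg3,
        hc.reg4, hc.reg5, hc.reg14, hc.reg16, hc.reg17, hc.arr0]
    · constructor <;> simp [Instr.apply, hc.idx1, hc.reg4, h0, hb, nodeB, nodeM, nodeH, nodeG,
        nodeE]
    · simp [Instr.apply, hw.idx5]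
    · simp [Instr.apply, hw.pos]
    · simp
    rintro m ⟨hc, hn, hw, -⟩
    refine (runs_line rfl).seq ?_
    rintro m1 rfl
    -- The root is already done; the loop treats nodes 1 to 2^(I+1) - 1, the levels 0 to `I`, which
    -- are those of interval length at least u.
    refine (Runs.while (N := 2 ^ (I + 1) - 1) (T := (ℓ * (n * 12 + 28) + 3) + 10)
      (fun j m' => ConstRegs n ℓ X u m' ∧ NodeRegs b (j + 1) m' ∧
        Written (treeOut n ℓ X b ω) ((j + 1) * ℓ) m' ∧ m'.reg 15 = 2 * nodeH (j + 1))
        ?_ ?_ ?_).seq ?_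
    · rintro j hj m ⟨hc, hn, hw, h15⟩
      refine ⟨?_, ?_⟩
      · rw [Test.Holds, hc.reg5, h15]
        refine hu2.trans ?_
        have e : ∀ a : ℕ, 2 * (1 / 2 : ℝ) ^ (a + 1) = (1 / 2) ^ a := fun a => by
          rw [pow_succ]; ring
        rw [nodeH, if_neg (Nat.succ_ne_zero j), e]
        refine pow_le_pow_of_le_one (by norm_num) (by norm_num) ?_
        refine Nat.lt_succ_iff.1 (Nat.log_lt_of_lt_pow (by omega) (by omega))
      · refine (runs_nodeCode hc hn hw h15).seq ?_
        rintro m' ⟨hc, hn, hw, h15⟩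
        exact runs_advanceCode (by omega) hc hn hw h15
    · rintro m ⟨hc, hn, hw, h15⟩
      rw [Test.Holds, hc.reg5, h15, not_le]
      have := nodeH_eq (i := I + 1) (p := 0) (by positivity)
      rw [add_zero] at this
      rw [Nat.sub_add_cancel hpos, this, pow_succ]
      linarith
    · refine ⟨?_, ?_, ⟨?_, ?_, ?_⟩, ?_⟩
      · constructor <;> simp [Instr.apply, hc.idx0, hc.idx1, hc.idx6, hc.idx7, hc.reg3,
          hc.reg4, hc.reg5, hc.reg14, hc.reg16, hc.reg17, hc.arr0]
      -- `reg 6` and `reg 9` carry over from the root, since `nodeB` and `nodeG` take equal values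
      -- at nodes 0 and 1.
      · constructor <;> simp [Instr.apply, hn.reg6, hn.reg9, nodeB, nodeM, nodeH, nodeG, nodeE]
      · simpa [Instr.apply] using hw.idx5
      · simpa [Instr.apply] using hw.pos
      · simpa [Instr.apply] using hw.arr1
      · simp [Instr.apply, nodeH]
    · rintro m ⟨hc, hn, hw, h15⟩
      rw [Nat.sub_add_cancel hpos] at hw
      refine runs_line ⟨?_, ?_, ?_, ?_⟩
      · simp [Instr.apply, hw.idx5, hc.idx7]
      · simp [Instr.apply, hw.idx5]
      · simp [Instr.apply, hw.pos]
      · simpa [Instr.apply] using hw.arr1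
  refine main.mono ?_ fun _ h => h
  obtain ⟨N, hN⟩ := Nat.exists_eq_add_of_le' hpos
  rw [hN, Nat.add_sub_cancel]
  have h1 : ℓ ≤ n * ℓ := Nat.le_mul_of_pos_left ℓ hn
  have h2 : 1 ≤ n * ℓ := Nat.mul_pos hn hℓ
  have h3 : ℓ * (n * 12 + 28) = 12 * (n * ℓ) + 28 * ℓ := by ring
  rw [h3]
  generalize n * ℓ = a at *
  nlinarith

/-! ### Releasing the noisy database itself -/

def localBody : Program :=
  .seq (line [.load 11 0 4]) <|
  .seq (line noiseCode) <|
  line [.store 1 5 8, .idxAdd 5 5 6, .store 1 5 11, .idxAdd 5 5 6, .store 1 5 9, .idxAdd 5 5 6,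
    .store 1 5 3, .idxAdd 5 5 6, .idxAdd 4 4 6]

/-- Release all coordinates of all points with noise. -/
def localCode : Program :=
  .seq (line [.cast 12 1, .div 6 12 0, .div 8 14 4, .const 9 4]) <|
  .seq (.while (.idxLt 2 0) (line [.idxAdd 3 3 1, .idxAdd 2 2 6])) <|
  .seq (.while (.idxLt 4 3) localBody) <|
  line [.idxAdd 0 5 7]

/-- The record is `(1 / n, x + noise, 4, 0)`; it contributes |x + noise - y|/n as long as the
truncation at 4 is inactive. -/
def localConst (n : ℕ) (_k c : ℕ) : ℝ :=
  if c = 0 then 1 / n else if c = 1 then 0 else if c = 2 then 4 else 0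

def localSlope (_k c : ℕ) : ℝ := if c = 1 then 1 else 0

def localStat (X : ℕ → ℝ) (s : ℝ) (ω : Tape) (k : ℕ) : ℝ := X k + logistic (ω k) * s

def localOut (n : ℕ) (X : ℕ → ℝ) (s : ℝ) (ω : Tape) (k c : ℕ) : ℝ :=
  localConst n k c + localSlope k c * localStat X s ω k

structure LocalRegs (n : ℕ) (s : ℝ) (m : State) : Prop where
  reg6 : m.reg 6 = s
  reg8 : m.reg 8 = 1 / n
  reg9 : m.reg 9 = 4

theorem runs_localCode {n ℓ : ℕ} (hn : 1 ≤ n) (hℓ : 1 ≤ ℓ) {X : ℕ → ℝ} {u ε : ℝ} {m : State}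
    (hc : ConstRegs n ℓ X u m) (hw : Written (localOut n X (ℓ / ε) ω) 0 m) (h0 : m.reg 0 = ε)
    (h2 : m.idx 2 = 0) (h3 : m.idx 3 = 0) (h4 : m.idx 4 = 0) :
    Runs ω localCode (33 * (n * ℓ)) m fun m' => m'.idx 0 = 4 * (n * ℓ) ∧
      Written (localOut n X (ℓ / ε) ω) (n * ℓ) m' := by
  set s : ℝ := ℓ / ε with hs
  have main : Runs ω localCode (5 + ((n * (3 + 1) + 1) + ((n * ℓ * ((2 + (7 + 10)) + 1) + 1) + 2)))
      m fun m' => m'.idx 0 = 4 * (n * ℓ) ∧ Written (localOut n X s ω) (n * ℓ) m' := by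
    refine (runs_line rfl).seq ?_
    rintro m1 rfl
    -- Indices cannot be multiplied, so nℓ is formed in `idx 3` by n additions of ℓ.
    refine (Runs.while (N := n) (T := 3)
      (fun j m' => ConstRegs n ℓ X u m' ∧ LocalRegs n s m' ∧ Written (localOut n X s ω) 0 m' ∧
        m'.idx 2 = j ∧ m'.idx 3 = j * ℓ ∧ m'.idx 4 = 0) ?_ ?_ ?_).seq ?_
    · rintro j hj m ⟨hc, hr, hw, h2, h3, h4⟩
      refine ⟨by simpa [Test.Holds, hc.idx0, h2] using hj, ?_⟩
      refine runs_line ⟨?_, ?_, ⟨?_, ?_, ?_⟩, ?_, ?_, ?_⟩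
      · constructor <;> simp [Instr.apply, hc.idx0, hc.idx1, hc.idx6, hc.idx7, hc.reg3,
          hc.reg4, hc.reg5, hc.reg14, hc.reg16, hc.reg17, hc.arr0]
      · constructor <;> simp [Instr.apply, hr.reg6, hr.reg8, hr.reg9]
      · simp [Instr.apply, hw.idx5]
      · simp [Instr.apply, hw.pos]
      · simp
      · simp [Instr.apply, h2, hc.idx6]
      · simp [Instr.apply, h3, hc.idx1]; ring
      · simp [Instr.apply, h4]
    · rintro m ⟨hc, -, -, h2, -, -⟩
      simp [Test.Holds, hc.idx0, h2]
    · refine ⟨?_, ?_, ⟨?_, ?_, ?_⟩, ?_, ?_, ?_⟩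
      · constructor <;> simp [Instr.apply, hc.idx0, hc.idx1, hc.idx6, hc.idx7, hc.reg3,
          hc.reg4, hc.reg5, hc.reg14, hc.reg16, hc.reg17, hc.arr0]
      · constructor <;> simp [Instr.apply, hc.idx1, h0, hc.reg14, hc.reg4, hs]
      · simp [Instr.apply, hw.idx5]
      · simp [Instr.apply, hw.pos]
      · simp
      · simp [Instr.apply, h2]
      · simp [Instr.apply, h3]
      · simp [Instr.apply, h4]
    rintro m ⟨hc, hr, hw, h2, h3, h4⟩
    refine (Runs.while (N := n * ℓ) (T := 2 + (7 + 10))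
      (fun k m' => ConstRegs n ℓ X u m' ∧ LocalRegs n s m' ∧ Written (localOut n X s ω) k m' ∧
        m'.idx 3 = n * ℓ ∧ m'.idx 4 = k) ?_ ?_ ⟨hc, hr, hw, h3, h4⟩).seq ?_
    · rintro k hk m ⟨hc, hr, hw, h3, h4⟩
      refine ⟨by simpa [Test.Holds, h3, h4] using hk, ?_⟩
      refine (runs_line rfl).seq ?_
      rintro m1 rfl
      refine (runs_line rfl).seq ?_
      rintro m2 rfl
      refine runs_line ⟨?_, ?_, ⟨?_, ?_, ?_⟩, ?_, ?_⟩
      · constructor <;> simp [noiseCode, Instr.apply, hc.idx0, hc.idx1, hc.idx6, hc.idx7, hc.reg3,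
          hc.reg4, hc.reg5, hc.reg14, hc.reg16, hc.reg17, hc.arr0]
      · constructor <;> simp [noiseCode, Instr.apply, hr.reg6, hr.reg8, hr.reg9]
      · simp [noiseCode, Instr.apply, hw.idx5, hc.idx6]; ring
      · simp [noiseCode, Instr.apply, hw.pos]
      · intro k' hk' c hc4
        rcases Nat.lt_succ_iff_lt_or_eq.1 hk' with hlt | rfl
        · rw [← hw.arr1 k' hlt c hc4]
          simp [noiseCode, Instr.apply, hw.idx5, hc.idx6, Function.update_apply]
          split_ifs <;> first | omega | rfl
        · have hc4' : c = 0 ∨ c = 1 ∨ c = 2 ∨ c = 3 := by omega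
          rcases hc4' with rfl | rfl | rfl | rfl <;>
            simp [noiseCode, Instr.apply, hw.idx5, hc.idx6, Function.update_apply, localOut,
              localConst, localSlope, localStat, logistic, hr.reg6, hr.reg8, hr.reg9, hc.reg3,
              hc.reg14, hw.pos, hc.arr0, h4]
          split_ifs <;> first | omega | rfl
      · simp [noiseCode, Instr.apply, h3]
      · simp [noiseCode, Instr.apply, h4, hc.idx6]
    · rintro m ⟨-, -, -, h3, h4⟩
      simp [Test.Holds, h3, h4]
    · rintro m ⟨hc, hr, hw, h3, h4⟩
      refine runs_line ⟨?_, ?_, ?_, ?_⟩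
      · simp [Instr.apply, hw.idx5, hc.idx7]
      · simp [Instr.apply, hw.idx5]
      · simp [Instr.apply, hw.pos]
      · simpa [Instr.apply] using hw.arr1
  refine main.mono ?_ fun _ h => h
  have h1 : n ≤ n * ℓ := Nat.le_mul_of_pos_right n hℓ
  have h2 : 1 ≤ n * ℓ := Nat.mul_pos hn hℓ
  generalize n * ℓ = a at *
  omega

/-- Compute `u = ℓ * log (n * ℓ / β) / (n * ε)` and the constants. -/
def setupCode : List Instr :=
  [.idxConst 6 1, .cast 4 0, .const 14 1, .cast 12 1, .mul 13 4 12, .div 13 13 2, .log 13 13,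
    .mul 13 12 13, .mul 11 4 0, .div 5 13 11, .mul 13 4 4, .mul 13 13 13, .mul 13 13 4,
    .mul 13 13 5, .const 16 (1 / 2), .const 17 (3 / 4)]

/-- The release program. -/
def releaseProgram : Program :=
  .seq (line setupCode) (.ite (.regLe 14 5) (line [.idxConst 0 0])
    (.ite (.regLe 13 14) localCode treeCode))

/-- The error scale of the mechanism. -/
def errorScale (n ℓ : ℕ) (ε β : ℝ) : ℝ := ℓ * Real.log (n * ℓ / β) / (n * ε)

/-- The coordinates of the data points, listed point by point. -/
def flat {n ℓ : ℕ} (D : Database n ℓ) : ℕ → ℝ := (releaseInput 0 0 0 D).arr 0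

theorem releaseOutput_eq {out : ℕ → ℕ → ℝ} {A B : ℕ → ℕ → ℝ} {z : ℕ → ℝ} {N : ℕ} {m : State}
    (h0 : m.idx 0 = 4 * N) (hw : Written out N m) (hout : ∀ k c, out k c = A k c + B k c * z k) :
    releaseOutput m = records N A B z := by
  unfold releaseOutput records
  have h : ∀ i < 4 * N, m.arr 1 i = A (i / 4) (i % 4) + B (i / 4) (i % 4) * z (i / 4) := by
    intro i hi
    rw [← hout, ← hw.arr1 (i / 4) (by omega) (i % 4) (by omega), Nat.div_add_mod]
  rw [h0]
  simp only [Sigma.mk.injEq, true_and, heq_eq_eq]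
  funext i
  exact h i i.2

theorem runs_releaseProgram {n ℓ T : ℕ} {ε δ β : ℝ} {D : Database n ℓ} {P : State → Prop}
    (h : ∀ m, ConstRegs n ℓ (flat D) (errorScale n ℓ ε β) m → (∀ out, Written out 0 m) →
      m.reg 0 = ε → m.idx 2 = 0 → m.idx 3 = 0 → m.idx 4 = 0 →
      m.reg 13 = n ^ 5 * errorScale n ℓ ε β →
      Runs ω (.ite (.regLe 14 5) (line [.idxConst 0 0]) (.ite (.regLe 13 14) localCode treeCode))
        T m P) :
    Runs ω releaseProgram (17 + T) (releaseInput ε δ β D) P := by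
  refine (runs_line rfl).seq ?_
  rintro m rfl
  refine h _ ?_ (fun out => ⟨?_, ?_, ?_⟩) ?_ ?_ ?_ ?_ ?_
  · constructor <;> simp [setupCode, Instr.apply, releaseInput, errorScale]
    funext i
    simp [flat, releaseInput]
  all_goals simp only [setupCode, List.foldl, Instr.apply, releaseInput, errorScale]
  all_goals simp
  exact Or.inl (by ring)

theorem releases_of_runs {M : Program} {n ℓ T N : ℕ} {ε δ β : ℝ} {D : Database n ℓ}
    {A B out : ℕ → ℕ → ℝ} {z : ℕ → ℝ}
    (h : Runs ω M T (releaseInput ε δ β D) fun m => m.idx 0 = 4 * N ∧ Written out N m)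
    (hout : ∀ k c, out k c = A k c + B k c * z k) :
    ∃ t, Releases M ε δ β D ω (records N A B z) t ∧ t ≤ T := by
  obtain ⟨m, t, he, ht, h0, hw⟩ := h
  exact ⟨t, ⟨m, he, releaseOutput_eq h0 hw hout⟩, ht⟩

/-! ### The three regimes of the release program -/

theorem releases_of_one_le_errorScale {n ℓ : ℕ} {ε δ β : ℝ} (hu : 1 ≤ errorScale n ℓ ε β)
    (D : Database n ℓ) (ω : Tape) (A B : ℕ → ℕ → ℝ) (z : ℕ → ℝ) :
    ∃ t, Releases releaseProgram ε δ β D ω (records 0 A B z) t ∧ t ≤ 20 := by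
  refine releases_of_runs (out := fun k c => A k c + B k c * z k) ?_ fun _ _ => rfl
  refine runs_releaseProgram (T := 3) fun m hc hw _ _ _ _ _ => Runs.ite (fun _ => ?_) fun hb => ?_
  · refine runs_line ⟨?_, ?_, ?_, ?_⟩
    · simp [Instr.apply]
    · simp [Instr.apply, (hw fun _ _ => 0).idx5]
    · simp [Instr.apply, (hw fun _ _ => 0).pos]
    · simp
  · simp only [Test.Holds, hc.reg14, hc.reg5] at hb
    exact absurd hu hb

theorem releases_local {n ℓ : ℕ} (hn : 1 ≤ n) (hℓ : 1 ≤ ℓ) {ε δ β : ℝ}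
    (hu : errorScale n ℓ ε β < 1) (hu' : n ^ 5 * errorScale n ℓ ε β ≤ 1)
    (D : Database n ℓ) (ω : Tape) :
    ∃ t, Releases releaseProgram ε δ β D ω
      (records (n * ℓ) (localConst n) localSlope (localStat (flat D) (ℓ / ε) ω)) t ∧
      t ≤ 52 * (n * ℓ) := by
  have h : Runs ω releaseProgram (17 + (33 * (n * ℓ) + 2)) (releaseInput ε δ β D) fun m' =>
      m'.idx 0 = 4 * (n * ℓ) ∧ Written (localOut n (flat D) (ℓ / ε) ω) (n * ℓ) m' := by
    refine runs_releaseProgram fun m hc hw h0 h2 h3 h4 h13 => Runs.ite (fun hb => ?_) fun _ =>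
      Runs.ite (fun _ => ?_) fun hb => ?_
    · simp only [Test.Holds, hc.reg14, hc.reg5] at hb
      exact absurd hb (not_le.2 hu)
    · exact runs_localCode hn hℓ hc (hw _) h0 h2 h3 h4
    · simp only [Test.Holds, hc.reg14, h13] at hb
      exact absurd hu' hb
  obtain ⟨t, h1, h2⟩ := releases_of_runs h fun _ _ => rfl
  have h3 : 1 ≤ n * ℓ := Nat.mul_pos hn hℓ
  exact ⟨t, h1, by omega⟩

theorem releases_tree {n ℓ I : ℕ} (hn : 1 ≤ n) (hℓ : 1 ≤ ℓ) {ε δ β : ℝ}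
    (hu : errorScale n ℓ ε β < 1) (hu' : 1 < n ^ 5 * errorScale n ℓ ε β)
    (hI : (1 / 2) ^ (I + 1) < errorScale n ℓ ε β) (hI' : errorScale n ℓ ε β ≤ (1 / 2) ^ I)
    (D : Database n ℓ) (ω : Tape) :
    ∃ t, Releases releaseProgram ε δ β D ω
      (records (2 ^ (I + 1) * ℓ) (treeConst ℓ) (treeSlope ℓ)
        (treeStat n ℓ (flat D) (4 * ℓ / (n * ε)) ω)) t ∧
      t ≤ 119 * (n * ℓ) * 2 ^ (I + 1) := by
  have h : Runs ω releaseProgram (17 + (100 * (n * ℓ) * 2 ^ (I + 1) + 2)) (releaseInput ε δ β D)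
      fun m' => m'.idx 0 = 4 * (2 ^ (I + 1) * ℓ) ∧
        Written (treeOut n ℓ (flat D) (4 * ℓ / (n * ε)) ω) (2 ^ (I + 1) * ℓ) m' := by
    refine runs_releaseProgram fun m hc hw h0 h2 h3 h4 h13 => Runs.ite (fun hb => ?_) fun _ =>
      Runs.ite (fun hb => ?_) fun hb => ?_
    · simp only [Test.Holds, hc.reg14, hc.reg5] at hb
      exact absurd hb (not_le.2 hu)
    · simp only [Test.Holds, hc.reg14, h13] at hb
      exact absurd hb (not_le.2 hu')
    · exact runs_treeCode hn hℓ hI hI' hc (hw _) h0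
  obtain ⟨t, h1, h2⟩ := releases_of_runs h fun _ _ => rfl
  have h3 : 1 ≤ n * ℓ := Nat.mul_pos hn hℓ
  have h4 : 1 ≤ 2 ^ (I + 1) := Nat.one_le_two_pow
  have h5 : 1 ≤ n * ℓ * 2 ^ (I + 1) := Nat.mul_pos h3 h4
  exact ⟨t, h1, by rw [mul_assoc] at h2 ⊢; omega⟩

/-! ### Accuracy and sensitivity -/

theorem coord_mem {ℓ : ℕ} (y : Point ℓ) (i : ℕ) : coord y i ∈ Set.Icc (0 : ℝ) 1 := by
  unfold coord
  split
  · exact (y _).2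
  · simp

theorem flat_mul_add {n ℓ : ℕ} (D : Database n ℓ) {j i : ℕ} (hj : j < n) (hi : i < ℓ) :
    flat D (j * ℓ + i) = D ⟨j, hj⟩ ⟨i, hi⟩ := by
  have hdiv : (j * ℓ + i) / ℓ = j := by
    rw [mul_comm, Nat.mul_add_div (by omega), Nat.div_eq_of_lt hi, add_zero]
  have hmod : (j * ℓ + i) % ℓ = i := by
    rw [mul_comm, Nat.mul_add_mod, Nat.mod_eq_of_lt hi]
  have hlt : j * ℓ + i < n * ℓ := by nlinarith
  simp only [flat, releaseInput, hdiv, hmod, hlt, true_and, dite_true]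

theorem flat_mem {n ℓ : ℕ} (D : Database n ℓ) (k : ℕ) : flat D k ∈ Set.Icc (0 : ℝ) 1 := by
  simp only [flat, releaseInput]
  split
  · exact (D _ _).2
  · simp

theorem sum_range_mul_div_mod (a : ℕ) {ℓ : ℕ} (f : ℕ → ℕ → ℝ) :
    ∑ k ∈ Finset.range (a * ℓ), f (k / ℓ) (k % ℓ) =
      ∑ v ∈ Finset.range a, ∑ i ∈ Finset.range ℓ, f v i := by
  induction a with
  | zero => simp
  | succ a ih =>
    rw [add_mul, one_mul, Finset.sum_range_add, ih, Finset.sum_range_succ]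
    congr 1
    refine Finset.sum_congr rfl fun i hi => ?_
    rw [Finset.mem_range] at hi
    rw [mul_comm, Nat.mul_add_div (by omega), Nat.div_eq_of_lt hi, add_zero, Nat.mul_add_mod,
      Nat.mod_eq_of_lt hi]

theorem answer_eq {n ℓ : ℕ} (D : Database n ℓ) (y : Point ℓ) : answer D y =
    ∑ i ∈ Finset.range ℓ, (∑ j ∈ Finset.range n, |flat D (j * ℓ + i) - coord y i|) / n := by
  rw [answer, ← Finset.sum_div, Finset.sum_comm, Finset.sum_range]
  congr 1
  refine Finset.sum_congr rfl fun j _ => ?_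
  rw [l1Dist, Finset.sum_range]
  refine Finset.sum_congr rfl fun i _ => ?_
  rw [flat_mul_add D j.2 i.2, coord, dif_pos i.2]

theorem answer_mem {n ℓ : ℕ} (hn : 1 ≤ n) (D : Database n ℓ) (y : Point ℓ) :
    answer D y ∈ Set.Icc (0 : ℝ) ℓ := by
  have hn' : (0 : ℝ) < n := by exact_mod_cast hn
  rw [answer_eq]
  refine ⟨Finset.sum_nonneg fun i _ => by positivity, ?_⟩
  refine (Finset.sum_le_card_nsmul (Finset.range ℓ) _ 1 fun i _ => ?_).trans (by simp)
  rw [div_le_one hn']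
  refine (Finset.sum_le_card_nsmul (Finset.range n) _ 1 fun j _ => ?_).trans (by simp)
  have h1 := flat_mem D (j * ℓ + i)
  have h2 := coord_mem y i
  rw [abs_le]; constructor <;> linarith [h1.1, h1.2, h2.1, h2.2]

theorem records_entry {N : ℕ} {A B : ℕ → ℕ → ℝ} {z : ℕ → ℝ} {k c : ℕ} (hk : k < N) (hc : c < 4) :
    (records N A B z).entry (4 * k + c) = A k c + B k c * z k := by
  have h1 : (4 * k + c) / 4 = k := by omega
  have h2 : (4 * k + c) % 4 = c := by omega
  have h3 : 4 * k + c < (records N A B z).1 := by simp only [records]; omega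
  rw [DataStructure.entry, dif_pos h3]
  simp only [records, h1, h2]

theorem estimate_records {ℓ N : ℕ} (A B : ℕ → ℕ → ℝ) (z : ℕ → ℝ) (y : Point ℓ) :
    estimate N (records N A B z) y = ∑ k ∈ Finset.range N, ((A k 0 + B k 0 * z k) *
      truncDist (A k 1 + B k 1 * z k) (A k 2 + B k 2 * z k) (coord y (k % ℓ)) +
        (A k 3 + B k 3 * z k)) := by
  refine Finset.sum_congr rfl fun k hk => ?_
  rw [Finset.mem_range] at hk
  have h0 := records_entry (A := A) (B := B) (z := z) hk (c := 0) (by norm_num)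
  rw [add_zero] at h0
  rw [h0, records_entry hk (by norm_num), records_entry hk (by norm_num),
    records_entry hk (by norm_num)]

/-- `nodeTerm` is affine in its statistic, so averaged statistics yield the average of the one-point
interpolants. -/
theorem nodeTerm_average {n : ℕ} (hn : 1 ≤ n) (v : ℕ) (s : ℕ → ℝ) (y : ℝ) :
    nodeTerm v ((∑ j ∈ Finset.range n, s j) / n) y =
      (∑ j ∈ Finset.range n, nodeTerm v (s j) y) / n := by
  have hn' : (n : ℝ) ≠ 0 := by positivity
  simp only [nodeTerm, Finset.sum_add_distrib, Finset.sum_sub_distrib, ← Finset.sum_mul,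
    Finset.sum_const, Finset.card_range, nsmul_eq_mul, mul_one]
  field_simp

/-- In each coordinate the error splits into the interpolation error (1/2)^J and the noise, whose
weights sum to at most 5 by `sum_nodeB_mul_le`. -/
theorem abs_estimate_tree_sub_answer_le {n ℓ : ℕ} (hn : 1 ≤ n) (J : ℕ) {t b : ℝ} (hb : 0 < b)
    (D : Database n ℓ) (hω : ∀ k < 2 ^ J * ℓ, |logistic (ω k)| ≤ t) (y : Point ℓ) :
    |estimate (2 ^ J * ℓ) (records (2 ^ J * ℓ) (treeConst ℓ) (treeSlope ℓ)
      (treeStat n ℓ (flat D) b ω)) y - answer D y| ≤ ℓ * ((1 / 2) ^ J + 5 * (t * b)) := by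
  have hn' : (0 : ℝ) < n := by exact_mod_cast hn
  have h1 : estimate (2 ^ J * ℓ) (records (2 ^ J * ℓ) (treeConst ℓ) (treeSlope ℓ)
      (treeStat n ℓ (flat D) b ω)) y = ∑ k ∈ Finset.range (2 ^ J * ℓ),
        (nodeTerm (k / ℓ) (stat n ℓ (flat D) (k / ℓ) (k % ℓ)) (coord y (k % ℓ)) +
          logistic (ω (k / ℓ * ℓ + k % ℓ)) * (b * nodeB (k / ℓ)) *
            (1 - nodeG (k / ℓ) * truncDist (nodeM (k / ℓ)) (nodeH (k / ℓ)) (coord y (k % ℓ)))) := by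
    rw [estimate_records]
    refine Finset.sum_congr rfl fun k _ => ?_
    rw [Nat.div_add_mod', ← nodeTerm_add]
    simp [treeConst, treeSlope, treeStat, nodeTerm]
    ring
  rw [h1, sum_range_mul_div_mod (2 ^ J) (fun v i => nodeTerm v (stat n ℓ (flat D) v i) (coord y i) +
    logistic (ω (v * ℓ + i)) * (b * nodeB v) *
      (1 - nodeG v * truncDist (nodeM v) (nodeH v) (coord y i))), Finset.sum_comm, answer_eq,
    ← Finset.sum_sub_distrib]
  refine (Finset.abs_sum_le_sum_abs _ _).trans ?_
  refine (Finset.sum_le_card_nsmul (Finset.range ℓ) _ ((1 / 2) ^ J + 5 * (t * b)) fun i hi => ?_).trans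
    (by rw [Finset.card_range, nsmul_eq_mul])
  rw [Finset.mem_range] at hi
  rw [Finset.sum_add_distrib, add_sub_right_comm]
  refine (abs_add_le _ _).trans (add_le_add ?_ ?_)
  · have h2 : ∀ v ∈ Finset.range (2 ^ J), nodeTerm v (stat n ℓ (flat D) v i) (coord y i) =
        (∑ j ∈ Finset.range n, nodeTerm v (truncDist (nodeM v) (nodeH v) (flat D (j * ℓ + i)))
          (coord y i)) / n := fun v _ => nodeTerm_average hn v _ _
    rw [Finset.sum_congr rfl h2, ← Finset.sum_div, Finset.sum_comm, ← sub_div,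
      ← Finset.sum_sub_distrib, abs_div, abs_of_pos hn', div_le_iff₀ hn']
    refine (Finset.abs_sum_le_sum_abs _ _).trans ?_
    refine (Finset.sum_le_card_nsmul (Finset.range n) _ ((1 / 2) ^ J) fun j _ => ?_).trans
      (by simp [mul_comm])
    exact abs_sum_nodeTerm_sub_le (flat_mem _ _) (coord_mem _ _) J
  · refine (Finset.abs_sum_le_sum_abs _ _).trans ?_
    have h3 : ∀ v ∈ Finset.range (2 ^ J), |logistic (ω (v * ℓ + i)) * (b * nodeB v) *
        (1 - nodeG v * truncDist (nodeM v) (nodeH v) (coord y i))| ≤ t * b * (nodeB v *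
          |1 - nodeG v * truncDist (nodeM v) (nodeH v) (coord y i)|) := by
      intro v hv
      rw [Finset.mem_range] at hv
      have hlt : v * ℓ + i < 2 ^ J * ℓ := by nlinarith
      rw [abs_mul, abs_mul, abs_of_pos (mul_pos hb (nodeB_pos v)), ← mul_assoc, ← mul_assoc]
      have := hω _ hlt
      have := nodeB_pos v
      gcongr
    refine (Finset.sum_le_sum h3).trans ?_
    rw [← Finset.mul_sum, mul_comm 5]
    have ht : 0 ≤ t := (abs_nonneg _).trans (hω i (by nlinarith [Nat.one_le_two_pow (n := J)]))
    gcongr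
    exact sum_nodeB_mul_le (coord_mem _ _) J

/-- Noise of at most 3 keeps x + noise within 4 of y, so nothing is truncated and each distance
moves by at most the noise. -/
theorem abs_estimate_local_sub_answer_le {n ℓ : ℕ} (hn : 1 ≤ n) {t s : ℝ} (hs : 0 < s)
    (hts : t * s ≤ 3) (D : Database n ℓ) (hω : ∀ k < n * ℓ, |logistic (ω k)| ≤ t) (y : Point ℓ) :
    |estimate (n * ℓ) (records (n * ℓ) (localConst n) localSlope (localStat (flat D) s ω)) y -
      answer D y| ≤ ℓ * (t * s) := by
  have hn' : (0 : ℝ) < n := by exact_mod_cast hn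
  have h1 : estimate (n * ℓ) (records (n * ℓ) (localConst n) localSlope
      (localStat (flat D) s ω)) y = ∑ k ∈ Finset.range (n * ℓ),
        1 / n * truncDist (flat D (k / ℓ * ℓ + k % ℓ) + logistic (ω (k / ℓ * ℓ + k % ℓ)) * s) 4
          (coord y (k % ℓ)) := by
    rw [estimate_records]
    refine Finset.sum_congr rfl fun k _ => ?_
    rw [Nat.div_add_mod']
    simp [localConst, localSlope, localStat]
  rw [h1, sum_range_mul_div_mod n (fun j i => 1 / n * truncDist (flat D (j * ℓ + i) +
    logistic (ω (j * ℓ + i)) * s) 4 (coord y i)), Finset.sum_comm, answer_eq,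
    ← Finset.sum_sub_distrib]
  refine (Finset.abs_sum_le_sum_abs _ _).trans ?_
  refine (Finset.sum_le_card_nsmul (Finset.range ℓ) _ (t * s) fun i hi => ?_).trans (by simp)
  rw [Finset.mem_range] at hi
  rw [← Finset.mul_sum, one_div_mul_eq_div, ← sub_div, ← Finset.sum_sub_distrib, abs_div,
    abs_of_pos hn', div_le_iff₀ hn']
  refine (Finset.abs_sum_le_sum_abs _ _).trans ?_
  refine (Finset.sum_le_card_nsmul (Finset.range n) _ (t * s) fun j hj => ?_).trans
    (by simp [mul_comm])
  rw [Finset.mem_range] at hj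
  have hlt : j * ℓ + i < n * ℓ := by nlinarith
  have hz : |logistic (ω (j * ℓ + i)) * s| ≤ t * s := by
    rw [abs_mul, abs_of_pos hs]
    have := hω _ hlt
    gcongr
  have h1 := flat_mem D (j * ℓ + i)
  have h2 := coord_mem y i
  generalize logistic (ω (j * ℓ + i)) * s = e at *
  generalize flat D (j * ℓ + i) = x at *
  generalize coord y i = y at *
  rw [abs_le] at hz
  rw [truncDist, min_eq_right, abs_sub_comm x]
  · refine (abs_abs_sub_abs_le _ _).trans ?_
    rw [abs_le]; constructor <;> linarith
  · rw [abs_le]; constructor <;> linarith [h1.1, h1.2, h2.1, h2.2]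

/-! ### Sensitivity of the released statistics -/

theorem Adjacent.exists_forall_ne {n ℓ : ℕ} (hn : 1 ≤ n) {D D' : Database n ℓ}
    (h : Adjacent D D') : ∃ j₀ : ℕ, j₀ < n ∧ ∀ j ≠ j₀, ∀ i < ℓ, flat D (j * ℓ + i) = flat D' (j * ℓ + i) := by
  classical
  have hne : Nonempty (Fin n) := ⟨⟨0, hn⟩⟩
  have hcard : (Finset.univ.filter fun j => D j ≠ D' j).card ≤ 1 := by
    unfold Adjacent hammingDist at h
    convert h
  obtain ⟨j₀, hj₀⟩ := Finset.card_le_one_iff_subset_singleton.1 hcard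
  refine ⟨j₀, j₀.2, fun j hj i hi => ?_⟩
  by_cases hjn : j < n
  · rw [flat_mul_add D hjn hi, flat_mul_add D' hjn hi]
    by_contra hcon
    have : (⟨j, hjn⟩ : Fin n) ∈ ({j₀} : Finset (Fin n)) :=
      hj₀ (by simp only [Finset.mem_filter, Finset.mem_univ, true_and]
              exact fun h => hcon (by rw [h]))
    rw [Finset.mem_singleton] at this
    exact hj (by rw [← this])
  · have hge : ¬ j * ℓ + i < n * ℓ := by nlinarith
    simp [flat, releaseInput, hge]

/-- One point enters each average with weight 1/n. The 4 in the noise unit 4ℓ/(nε) cancels the bound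
of `sum_abs_truncDist_sub_div_nodeB_le`, leaving ε/ℓ per coordinate. -/
theorem sum_tree_sensitivity_le {n ℓ : ℕ} (hn : 1 ≤ n) (hℓ : 1 ≤ ℓ) (J : ℕ) {ε : ℝ} (hε : 0 < ε)
    {D D' : Database n ℓ} (h : Adjacent D D') :
    ∑ k ∈ Finset.range (2 ^ J * ℓ), |stat n ℓ (flat D) (k / ℓ) (k % ℓ) -
      stat n ℓ (flat D') (k / ℓ) (k % ℓ)| / (4 * ℓ / (n * ε) * nodeB (k / ℓ)) ≤ ε := by
  have hn' : (0 : ℝ) < n := by exact_mod_cast hn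
  have hℓ' : (0 : ℝ) < ℓ := by exact_mod_cast hℓ
  obtain ⟨j₀, hj₀, hne⟩ := h.exists_forall_ne hn
  rw [sum_range_mul_div_mod (2 ^ J) (fun v i => |stat n ℓ (flat D) v i - stat n ℓ (flat D') v i| /
    (4 * ℓ / (n * ε) * nodeB v)), Finset.sum_comm]
  refine (Finset.sum_le_card_nsmul (Finset.range ℓ) _ (ε / ℓ) fun i hi => ?_).trans
    (by simp; field_simp; rfl)
  rw [Finset.mem_range] at hi
  have hterm : ∀ v ∈ Finset.range (2 ^ J), |stat n ℓ (flat D) v i - stat n ℓ (flat D') v i| /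
      (4 * ℓ / (n * ε) * nodeB v) = ε / (4 * ℓ) *
        (|truncDist (nodeM v) (nodeH v) (flat D (j₀ * ℓ + i)) -
          truncDist (nodeM v) (nodeH v) (flat D' (j₀ * ℓ + i))| / nodeB v) := by
    intro v _
    have hB := nodeB_pos v
    rw [stat, stat, ← sub_div, ← Finset.sum_sub_distrib,
      Finset.sum_eq_single_of_mem j₀ (Finset.mem_range.2 hj₀) fun j _ hj => by
        rw [hne j hj i hi, sub_self], abs_div, abs_of_pos hn']
    field_simp
  rw [Finset.sum_congr rfl hterm, ← Finset.mul_sum]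
  calc _ ≤ ε / (4 * ℓ) * 4 := by
        gcongr
        exact sum_abs_truncDist_sub_div_nodeB_le (flat_mem _ _) (flat_mem _ _) J
    _ = ε / ℓ := by field_simp

theorem sum_local_sensitivity_le {n ℓ : ℕ} (hn : 1 ≤ n) (hℓ : 1 ≤ ℓ) {ε : ℝ} (hε : 0 < ε)
    {D D' : Database n ℓ} (h : Adjacent D D') :
    ∑ k ∈ Finset.range (n * ℓ), |flat D k - flat D' k| / (ℓ / ε) ≤ ε := by
  have hℓ' : (0 : ℝ) < ℓ := by exact_mod_cast hℓ
  obtain ⟨j₀, hj₀, hne⟩ := h.exists_forall_ne hn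
  have h1 : ∀ k ∈ Finset.range (n * ℓ), |flat D k - flat D' k| / (ℓ / ε) =
      |flat D (k / ℓ * ℓ + k % ℓ) - flat D' (k / ℓ * ℓ + k % ℓ)| / (ℓ / ε) := fun k _ => by
    rw [Nat.div_add_mod']
  rw [Finset.sum_congr rfl h1, sum_range_mul_div_mod n (fun j i =>
    |flat D (j * ℓ + i) - flat D' (j * ℓ + i)| / (ℓ / ε)),
    Finset.sum_eq_single_of_mem j₀ (Finset.mem_range.2 hj₀) fun j _ hj =>
      Finset.sum_eq_zero fun i hi => by
        rw [hne j hj i (Finset.mem_range.1 hi), sub_self, abs_zero, zero_div]]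
  refine (Finset.sum_le_card_nsmul (Finset.range ℓ) _ (ε / ℓ) fun i hi => ?_).trans
    (by simp; field_simp; rfl)
  rw [div_div_eq_mul_div]
  gcongr
  refine mul_le_of_le_one_left hε.le ?_
  have h1 := flat_mem D (j₀ * ℓ + i)
  have h2 := flat_mem D' (j₀ * ℓ + i)
  rw [abs_le]; constructor <;> linarith [h1.1, h1.2, h2.1, h2.2]

/-! ### The mechanism -/

/-- The exceptional event concerns the noise alone, so accuracy for all y at once needs no union
bound over queries. -/
theorem isAccurate_of_releases_records {n ℓ N : ℕ} (hℓ : 1 ≤ ℓ) {ε δ β α t : ℝ}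
    {A B : ℕ → ℕ → ℝ} {z : Database n ℓ → Tape → ℕ → ℝ}
    (hM : ∀ D ω, ∃ s, Releases releaseProgram ε δ β D ω (records N A B (z D ω)) s)
    (hα : ∀ D ω, (∀ k < N, |logistic (ω k)| ≤ t) → ∀ y : Point ℓ,
      |estimate N (records N A B (z D ω)) y - answer D y| ≤ α)
    (ht : N * (2 / (1 + Real.exp t)) ≤ β) :
    IsAccurate releaseProgram queryProgram n ℓ ε δ β α := by
  intro D
  refine (measure_mono fun ω hω => ?_).trans
    ((tapeLaw_exists_lt_abs_logistic_le N t).trans (ENNReal.ofReal_le_ofReal ht))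
  by_contra hcon
  simp only [Set.mem_ofPred_eq, not_exists, not_and, not_lt] at hcon hω
  obtain ⟨s, hs⟩ := hM D ω
  obtain ⟨y, hy⟩ := not_forall.1 (hω _ _ hs)
  obtain ⟨t', ht', -⟩ := answers_queryProgram hℓ N (records N A B (z D ω)) rfl y
  exact hy ⟨_, t', ht', hα D ω hcon y⟩

theorem runsWithin_of_releases_records {n ℓ N T : ℕ} (hℓ : 1 ≤ ℓ) {ε δ β T₁ T₂ : ℝ}
    {A B : ℕ → ℕ → ℝ} {z : Database n ℓ → Tape → ℕ → ℝ}
    (hM : ∀ D ω, ∃ s, Releases releaseProgram ε δ β D ω (records N A B (z D ω)) s ∧ s ≤ T)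
    (h₁ : (T : ℝ) ≤ T₁) (h₂ : 26 * (N : ℝ) + 3 ≤ T₂) :
    RunsWithin releaseProgram queryProgram n ℓ ε δ β T₁ T₂ := by
  intro D ω
  obtain ⟨s, hs, hsT⟩ := hM D ω
  refine ⟨_, s, hs, le_trans (by exact_mod_cast hsT) h₁, fun y => ?_⟩
  obtain ⟨t', ht', hle⟩ := answers_queryProgram hℓ N (records N A B (z D ω)) rfl y
  exact ⟨_, t', ht', le_trans (by exact_mod_cast hle) h₂⟩

/-- What is shown about the mechanism, with `u = errorScale n ℓ ε β`. -/
def MechanismSpec (n ℓ : ℕ) (ε δ β : ℝ) : Prop :=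
  IsDP releaseProgram n ℓ ε δ β ∧ ∃ α : ℝ, 0 < α ∧
    α ≤ 141 * (ℓ * errorScale n ℓ ε β ^ (4 / 5 : ℝ)) ∧
    α ≤ 141 * (ℓ * errorScale n ℓ ε β ^ (2 / 3 : ℝ)) ∧
    IsAccurate releaseProgram queryProgram n ℓ ε δ β α ∧
    RunsWithin releaseProgram queryProgram n ℓ ε δ β
      (min (40000 * ((ℓ : ℝ) ^ 3 * (n : ℝ) ^ 2 / α)) (40000 * ((n : ℝ) * ℓ) ^ 6))
      (40000 * ((n : ℝ) * ℓ) ^ 6)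

/-- With no records the estimate is 0 and the answer lies in [0, ℓ]; α = ℓ is admissible because u ≥
1 gives u^r ≥ 1. -/
theorem mechanismSpec_trivial {n ℓ : ℕ} (hn : 1 ≤ n) (hℓ : 1 ≤ ℓ) {ε δ β : ℝ} (hε : 0 < ε)
    (hβ : 0 < β) (hu : 1 ≤ errorScale n ℓ ε β) : MechanismSpec n ℓ ε δ β := by
  have hn' : (1 : ℝ) ≤ n := by exact_mod_cast hn
  have hℓ' : (1 : ℝ) ≤ ℓ := by exact_mod_cast hℓ
  have hnℓ : 1 ≤ (n : ℝ) * ℓ := one_le_mul_of_one_le_of_one_le hn' hℓ'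
  have hM := fun (D : Database n ℓ) (ω : Tape) =>
    releases_of_one_le_errorScale (δ := δ) hu D ω (fun _ _ => 0) (fun _ _ => 0)
      (fun k => 0 + logistic (ω k) * 1)
  have hM' := fun D ω => (hM D ω).imp fun _ h => h.1
  have hbound : ∀ r : ℝ, 0 ≤ r → (ℓ : ℝ) ≤ 141 * (ℓ * errorScale n ℓ ε β ^ r) := fun r hr => by
    have := Real.one_le_rpow hu hr
    nlinarith
  refine ⟨isDP_of_releases_records 0 _ _ (fun _ _ => 0) (fun _ => 1) (fun _ => one_pos) hM'
    (fun _ _ _ => by simpa using hε.le), ℓ, by linarith, hbound _ (by norm_num),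
    hbound _ (by norm_num), isAccurate_of_releases_records (t := 0) hℓ hM' (fun D ω _ y => ?_)
      (by simpa using hβ.le), runsWithin_of_releases_records hℓ hM (le_min ?_ ?_) ?_⟩
  · have h := answer_mem hn D y
    rw [estimate, Finset.sum_range_zero, zero_sub, abs_neg, abs_of_nonneg h.1]
    exact h.2
  · have : (ℓ : ℝ) ^ 3 * n ^ 2 / ℓ = (n * ℓ) ^ 2 := by field_simp
    rw [this]
    have := one_le_pow₀ hnℓ (n := 2)
    push_cast
    linarith
  · have := one_le_pow₀ hnℓ (n := 6)
    push_cast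
    linarith
  · have := one_le_pow₀ hnℓ (n := 6)
    push_cast
    linarith

section

variable {n ℓ : ℕ} {ε δ β : ℝ}

theorem log_pos_of_inputs (hn : 1 ≤ n) (hℓ : 1 ≤ ℓ) (hβ : 0 < β) (hβ1 : β < 1) :
    0 < Real.log (n * ℓ / β) := by
  have hn' : (1 : ℝ) ≤ n := by exact_mod_cast hn
  have hℓ' : (1 : ℝ) ≤ ℓ := by exact_mod_cast hℓ
  have hnℓ : 1 ≤ (n : ℝ) * ℓ := one_le_mul_of_one_le_of_one_le hn' hℓ'
  refine Real.log_pos ?_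
  rw [lt_div_iff₀ hβ]
  linarith

theorem errorScale_pos (hn : 1 ≤ n) (hℓ : 1 ≤ ℓ) (hε : 0 < ε) (hβ : 0 < β) (hβ1 : β < 1) :
    0 < errorScale n ℓ ε β := by
  have := log_pos_of_inputs hn hℓ hβ hβ1
  unfold errorScale
  positivity

/-- The error is 2ℓnu, and n^5 u ≤ 1 is equivalent to nu ≤ u^(4/5). This is where the threshold n^5
comes from. -/
theorem mechanismSpec_local (hn : 1 ≤ n) (hℓ : 1 ≤ ℓ) (hε : 0 < ε)
    (hβ : 0 < β) (hβ1 : β < 1) (hu1 : errorScale n ℓ ε β < 1)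
    (hu2 : n ^ 5 * errorScale n ℓ ε β ≤ 1) : MechanismSpec n ℓ ε δ β := by
  have hn' : (1 : ℝ) ≤ n := by exact_mod_cast hn
  have hℓ' : (1 : ℝ) ≤ ℓ := by exact_mod_cast hℓ
  have hnℓ : 1 ≤ (n : ℝ) * ℓ := one_le_mul_of_one_le_of_one_le hn' hℓ'
  have hu0 := errorScale_pos hn hℓ hε hβ hβ1
  have hL := log_pos_of_inputs hn hℓ hβ hβ1
  have hM := fun (D : Database n ℓ) (ω : Tape) => releases_local (δ := δ) hn hℓ hu1 hu2 D ω
  have hM' := fun D ω => (hM D ω).imp fun _ h => h.1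
  have hts : 2 * Real.log (n * ℓ / β) * (ℓ / ε) = 2 * (n * errorScale n ℓ ε β) := by
    unfold errorScale
    field_simp
  have hpow : n * errorScale n ℓ ε β ≤ errorScale n ℓ ε β ^ (4 / 5 : ℝ) := by
    have h1 : ((n : ℝ) ^ 5 * errorScale n ℓ ε β) ^ (1 / 5 : ℝ) ≤ 1 :=
      Real.rpow_le_one (by positivity) hu2 (by norm_num)
    rw [Real.mul_rpow (by positivity) hu0.le, ← Real.rpow_natCast, ← Real.rpow_mul (by positivity)]
      at h1
    norm_num at h1
    have h2 : errorScale n ℓ ε β =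
        errorScale n ℓ ε β ^ (4 / 5 : ℝ) * errorScale n ℓ ε β ^ (1 / 5 : ℝ) := by
      rw [← Real.rpow_add hu0]; norm_num
    have h3 : 0 < errorScale n ℓ ε β ^ (4 / 5 : ℝ) := by positivity
    calc n * errorScale n ℓ ε β = errorScale n ℓ ε β ^ (4 / 5 : ℝ) *
          (n * errorScale n ℓ ε β ^ (1 / 5 : ℝ)) := by
          rw [mul_left_comm, ← h2]
      _ ≤ errorScale n ℓ ε β ^ (4 / 5 : ℝ) * 1 := by gcongr
      _ = _ := mul_one _
  have hpow' : errorScale n ℓ ε β ^ (4 / 5 : ℝ) ≤ errorScale n ℓ ε β ^ (2 / 3 : ℝ) :=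
    Real.rpow_le_rpow_of_exponent_ge hu0 hu1.le (by norm_num)
  have hnu : n * errorScale n ℓ ε β ≤ 1 := by
    have : (n : ℝ) ≤ n ^ 5 := le_self_pow₀ hn' (by norm_num)
    nlinarith
  have hs : (0 : ℝ) < ℓ / ε := by positivity
  have hp0 : 0 < errorScale n ℓ ε β ^ (4 / 5 : ℝ) := by positivity
  refine ⟨isDP_of_releases_records (n * ℓ) _ _ flat (fun _ => ℓ / ε) (fun _ => hs) hM'
    (fun D D' h => sum_local_sensitivity_le hn hℓ hε h), ℓ * (2 * (n * errorScale n ℓ ε β)),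
    by positivity, ?_, ?_, isAccurate_of_releases_records (t := 2 * Real.log (n * ℓ / β)) hℓ hM'
      (fun D ω hω y => ?_) ?_, runsWithin_of_releases_records hℓ hM (le_min ?_ ?_) ?_⟩
  · have := mul_le_mul_of_nonneg_left hpow (by positivity : (0 : ℝ) ≤ ℓ)
    nlinarith
  · have := mul_le_mul_of_nonneg_left (hpow.trans hpow') (by positivity : (0 : ℝ) ≤ ℓ)
    nlinarith
  · rw [← hts]
    exact abs_estimate_local_sub_answer_le hn hs (by rw [hts]; linarith) D hω y
  · have hE : Real.exp (Real.log (n * ℓ / β)) = n * ℓ / β := Real.exp_log (by positivity)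
    have hN : ((n * ℓ : ℕ) : ℝ) = β * Real.exp (Real.log (n * ℓ / β)) := by
      rw [hE]; push_cast; field_simp
    have h2 : Real.exp (2 * Real.log (n * ℓ / β)) = Real.exp (Real.log (n * ℓ / β)) ^ 2 := by
      rw [← Real.exp_nat_mul]; norm_num
    rw [hN, h2, mul_assoc]
    -- With E = nℓ/β the union bound reduces to 2E ≤ 1 + E².
    refine mul_le_of_le_one_right hβ.le ?_
    rw [← mul_div_assoc, div_le_one (by positivity)]
    nlinarith [sq_nonneg (Real.exp (Real.log (n * ℓ / β)) - 1)]
  · have : (ℓ : ℝ) ^ 3 * n ^ 2 / (ℓ * (2 * (n * errorScale n ℓ ε β))) =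
        (n * ℓ) * (ℓ / errorScale n ℓ ε β) / 2 := by field_simp
    rw [this]
    have h1 : 1 ≤ ℓ / errorScale n ℓ ε β := by
      rw [one_le_div hu0]; linarith
    have := le_mul_of_one_le_right (by positivity : (0 : ℝ) ≤ n * ℓ) h1
    push_cast
    linarith
  · have := le_self_pow₀ hnℓ (n := 6) (by norm_num)
    push_cast
    linarith
  · have := le_self_pow₀ hnℓ (n := 6) (by norm_num)
    push_cast
    linarith

/-- In α = 141ℓu, the interpolation accounts for 1 and the noise for 140 = 5 · 7 · 4: the weight
sum, the factor in t = 7 log(nℓ/β), and the noise unit. -/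
theorem mechanismSpec_tree (hn : 1 ≤ n) (hℓ : 1 ≤ ℓ) (hε : 0 < ε)
    (hβ : 0 < β) (hβ1 : β < 1) (hu1 : errorScale n ℓ ε β < 1)
    (hu2 : 1 < n ^ 5 * errorScale n ℓ ε β) : MechanismSpec n ℓ ε δ β := by
  have hn' : (1 : ℝ) ≤ n := by exact_mod_cast hn
  have hℓ' : (1 : ℝ) ≤ ℓ := by exact_mod_cast hℓ
  have hnℓ : 1 ≤ (n : ℝ) * ℓ := one_le_mul_of_one_le_of_one_le hn' hℓ'
  have hu0 := errorScale_pos hn hℓ hε hβ hβ1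
  -- For n = 1 the two conditions on u contradict each other. That n ≥ 2 later absorbs the factor 4
  -- of the union bound.
  have hn2 : (2 : ℝ) ≤ n := by
    have : n ≠ 1 := by
      rintro rfl
      norm_num at hu2
      linarith
    exact_mod_cast (show 2 ≤ n by omega)
  obtain ⟨I, hI, hI'⟩ := exists_nat_pow_near_of_lt_one hu0 hu1.le (by norm_num : (0 : ℝ) < 1 / 2)
    (by norm_num)
  have hM := fun (D : Database n ℓ) (ω : Tape) =>
    releases_tree (δ := δ) hn hℓ hu1 hu2 hI hI' D ω
  have hM' := fun D ω => (hM D ω).imp fun _ h => h.1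
  have hb : (0 : ℝ) < 4 * ℓ / (n * ε) := by positivity
  have htb : 5 * (7 * Real.log (n * ℓ / β) * (4 * ℓ / (n * ε))) = 140 * errorScale n ℓ ε β := by
    unfold errorScale
    ring
  have hcells : (2 : ℝ) ^ (I + 1) ≤ 2 / errorScale n ℓ ε β := by
    rw [one_div, inv_pow, le_inv_comm₀ hu0 (by positivity)] at hI'
    rw [pow_succ, mul_comm, div_eq_mul_inv]
    linarith
  -- The condition n^5 u > 1 makes the number of nodes polynomial in n.
  have hcells' : (2 : ℝ) ^ (I + 1) ≤ 2 * n ^ 5 := by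
    refine hcells.trans ?_
    rw [div_le_iff₀ hu0]
    linarith
  have hpoly : (n : ℝ) ^ 5 * ℓ * n ≤ (n * ℓ) ^ 6 := by
    have h1 : (ℓ : ℝ) ≤ ℓ ^ 6 := le_self_pow₀ hℓ' (by norm_num)
    calc (n : ℝ) ^ 5 * ℓ * n = (n : ℝ) ^ 6 * ℓ := by ring
      _ ≤ (n : ℝ) ^ 6 * (ℓ : ℝ) ^ 6 := by gcongr
      _ = _ := by ring
  have hpow : ∀ r : ℝ, r ≤ 1 → ℓ * (141 * errorScale n ℓ ε β) ≤
      141 * (ℓ * errorScale n ℓ ε β ^ r) := fun r hr => by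
    have h1 := Real.rpow_le_rpow_of_exponent_ge hu0 hu1.le hr
    rw [Real.rpow_one] at h1
    rw [mul_left_comm]
    gcongr
  refine ⟨isDP_of_releases_records (2 ^ (I + 1) * ℓ) _ _
    (fun D k => stat n ℓ (flat D) (k / ℓ) (k % ℓ)) (fun k => 4 * ℓ / (n * ε) * nodeB (k / ℓ))
    (fun k => mul_pos hb (nodeB_pos _)) hM'
    (fun D D' h => sum_tree_sensitivity_le hn hℓ (I + 1) hε h), ℓ * (141 * errorScale n ℓ ε β),
    by positivity, hpow _ (by norm_num), hpow _ (by norm_num),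
    isAccurate_of_releases_records (t := 7 * Real.log (n * ℓ / β)) hℓ hM'
      (fun D ω hω y => ?_) ?_, runsWithin_of_releases_records hℓ hM (le_min ?_ ?_) ?_⟩
  · refine (abs_estimate_tree_sub_answer_le hn (I + 1) hb D hω y).trans ?_
    rw [htb]
    gcongr
    linarith
  · have hE : Real.exp (7 * Real.log (n * ℓ / β)) = (n * ℓ / β) ^ 7 := by
      rw [show (7 : ℝ) = ((7 : ℕ) : ℝ) by norm_num, Real.exp_nat_mul, Real.exp_log (by positivity)]
    have hEβ : (n : ℝ) * ℓ ≤ n * ℓ / β := le_div_self (by positivity) hβ hβ1.le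
    have h4 : (4 : ℝ) ≤ n ^ 2 := by nlinarith
    -- At most 2n^5 ℓ variables, each with tail below 2e^(-t), require this inequality; the exponent
    -- 7 suffices.
    have h1 : (4 : ℝ) * n ^ 5 * ℓ ≤ β * (n * ℓ / β) ^ 7 := by
      have h2 : β * (n * ℓ / β) ^ 7 = (n * ℓ) * (n * ℓ / β) ^ 6 := by field_simp
      rw [h2]
      calc (4 : ℝ) * n ^ 5 * ℓ ≤ (n : ℝ) ^ 2 * (n : ℝ) ^ 5 * ℓ := by gcongr
        _ = ((n : ℝ) * ℓ) * (n : ℝ) ^ 6 := by ring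
        _ ≤ ((n : ℝ) * ℓ) * (n * ℓ / β) ^ 6 := by
          gcongr
          exact (le_mul_of_one_le_right (by positivity) hℓ').trans hEβ
    rw [hE, ← mul_div_assoc, div_le_iff₀ (by positivity)]
    push_cast
    have h5 : (2 : ℝ) ^ (I + 1) * ℓ ≤ 2 * n ^ 5 * ℓ := by gcongr
    linarith
  -- Here 40000 is large enough because 119 · 282 ≤ 40000, with 282 = 2 · 141.
  · have : (ℓ : ℝ) ^ 3 * n ^ 2 / (ℓ * (141 * errorScale n ℓ ε β)) =
        (n * ℓ) * (n * ℓ) * (2 / errorScale n ℓ ε β) / 282 := by field_simp; norm_num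
    rw [this]
    push_cast
    have h1 : (n : ℝ) * ℓ * 2 ^ (I + 1) ≤ (n * ℓ) * (2 / errorScale n ℓ ε β) := by gcongr
    have h2 : 0 < (n : ℝ) * ℓ * (2 / errorScale n ℓ ε β) := by positivity
    have h3 : (n : ℝ) * ℓ * (2 / errorScale n ℓ ε β) ≤
        (n * ℓ) * ((n * ℓ) * (2 / errorScale n ℓ ε β)) := le_mul_of_one_le_left h2.le hnℓ
    linarith
  · push_cast
    have h1 : (n : ℝ) * ℓ * 2 ^ (I + 1) ≤ (n * ℓ) * (2 * n ^ 5) := by gcongr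
    have h2 := one_le_pow₀ hnℓ (n := 6)
    linarith
  · push_cast
    have h1 : (2 : ℝ) ^ (I + 1) * ℓ ≤ 2 * n ^ 5 * ℓ := by gcongr
    have h2 : (n : ℝ) ^ 5 * ℓ ≤ n ^ 5 * ℓ * n := le_mul_of_one_le_right (by positivity) hn'
    have h3 := one_le_pow₀ hnℓ (n := 6)
    linarith

theorem mechanismSpec (hn : 1 ≤ n) (hℓ : 1 ≤ ℓ) (hε : 0 < ε) (hβ : 0 < β) (hβ1 : β < 1) :
    MechanismSpec n ℓ ε δ β := by
  rcases le_or_gt 1 (errorScale n ℓ ε β) with h1 | h1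
  · exact mechanismSpec_trivial hn hℓ hε hβ h1
  · rcases le_or_gt (n ^ 5 * errorScale n ℓ ε β) 1 with h2 | h2
    · exact mechanismSpec_local hn hℓ hε hβ hβ1 h1 h2
    · exact mechanismSpec_tree hn hℓ hε hβ hβ1 h1 h2

theorem errorScale_rpow (hn : 1 ≤ n) (hℓ : 1 ≤ ℓ) (hε : 0 < ε) (hβ : 0 < β) (hβ1 : β < 1) (r : ℝ) :
    errorScale n ℓ ε β ^ r =
      (ℓ : ℝ) ^ r * Real.log (n * ℓ / β) ^ r / ((n : ℝ) ^ r * ε ^ r) := by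
  have hL := log_pos_of_inputs hn hℓ hβ hβ1
  rw [errorScale, Real.div_rpow (by positivity) (by positivity),
    Real.mul_rpow (by positivity) hL.le, Real.mul_rpow (by positivity) hε.le]

end

end DistRelease

end

/-! ### From the error scale to the two stated bounds -/

theorem mainTheorem2 :
    (∃ (M Q : DistRelease.Program) (C : ℝ) (k : ℕ), 0 < C ∧
      ∀ n ℓ : ℕ, 1 ≤ n → 1 ≤ ℓ →
      ∀ ε δ β : ℝ, 0 < ε → 0 < δ → δ < 1 → 0 < β → β < 1 →
      DistRelease.IsDP M n ℓ ε δ β ∧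
      ∃ α : ℝ, 0 < α ∧
        α ≤ C * ((ℓ : ℝ) ^ (9 / 5 : ℝ) * Real.log (4 / δ) ^ (4 / 5 : ℝ) *
              Real.log ((n : ℝ) * ℓ / β) ^ (4 / 5 : ℝ) /
            ((n : ℝ) ^ (4 / 5 : ℝ) * ε ^ (4 / 5 : ℝ))) ∧
        DistRelease.IsAccurate M Q n ℓ ε δ β α ∧
        DistRelease.RunsWithin M Q n ℓ ε δ β
          (min (C * ((ℓ : ℝ) ^ 3 * (n : ℝ) ^ 2 / α)) (C * ((n : ℝ) * ℓ) ^ k))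
          (C * ((n : ℝ) * ℓ) ^ k)) ∧
    (∃ (M Q : DistRelease.Program) (C : ℝ) (k : ℕ), 0 < C ∧
      ∀ n ℓ : ℕ, 1 ≤ n → 1 ≤ ℓ →
      ∀ ε β : ℝ, 0 < ε → 0 < β → β < 1 →
      DistRelease.IsDP M n ℓ ε 0 β ∧
      ∃ α : ℝ, 0 < α ∧
        α ≤ C * ((ℓ : ℝ) ^ (7 / 3 : ℝ) * Real.log ((n : ℝ) * ℓ / β) ^ (2 / 3 : ℝ) /
            ((n : ℝ) ^ (2 / 3 : ℝ) * ε ^ (2 / 3 : ℝ))) ∧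
        DistRelease.IsAccurate M Q n ℓ ε 0 β α ∧
        DistRelease.RunsWithin M Q n ℓ ε 0 β
          (min (C * ((ℓ : ℝ) ^ 3 * (n : ℝ) ^ 2 / α)) (C * ((n : ℝ) * ℓ) ^ k))
          (C * ((n : ℝ) * ℓ) ^ k)) := by
  refine ⟨⟨DistRelease.releaseProgram, DistRelease.queryProgram, 40000, 6, by norm_num, ?_⟩,
    ⟨DistRelease.releaseProgram, DistRelease.queryProgram, 40000, 6, by norm_num, ?_⟩⟩
  · intro n ℓ hn hℓ ε δ β hε hδ hδ1 hβ hβ1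
    obtain ⟨hdp, α, hα, hle, -, hacc, hrun⟩ :=
      DistRelease.mechanismSpec (δ := δ) hn hℓ hε hβ hβ1
    refine ⟨hdp, α, hα, hle.trans ?_, hacc, hrun⟩
    have hℓ' : (0 : ℝ) < ℓ := by exact_mod_cast hℓ
    have hL := DistRelease.log_pos_of_inputs hn hℓ hβ hβ1
    -- As 4/δ > 4 > e, the factor log(4/δ)^(4/5) only enlarges the bound.
    have hlog : 1 ≤ Real.log (4 / δ) := by
      rw [Real.le_log_iff_exp_le (by positivity), le_div_iff₀ hδ]
      nlinarith [Real.exp_one_lt_d9, Real.exp_pos 1]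
    have h1 := Real.one_le_rpow hlog (by norm_num : (0 : ℝ) ≤ 4 / 5)
    rw [DistRelease.errorScale_rpow hn hℓ hε hβ hβ1, show (9 / 5 : ℝ) = 1 + 4 / 5 by norm_num,
      Real.rpow_add hℓ', Real.rpow_one]
    rw [show (ℓ : ℝ) * (ℓ : ℝ) ^ (4 / 5 : ℝ) * Real.log (4 / δ) ^ (4 / 5 : ℝ) *
        Real.log ((n : ℝ) * ℓ / β) ^ (4 / 5 : ℝ) / ((n : ℝ) ^ (4 / 5 : ℝ) * ε ^ (4 / 5 : ℝ)) =
        ℓ * ((ℓ : ℝ) ^ (4 / 5 : ℝ) * Real.log ((n : ℝ) * ℓ / β) ^ (4 / 5 : ℝ) /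
          ((n : ℝ) ^ (4 / 5 : ℝ) * ε ^ (4 / 5 : ℝ))) * Real.log (4 / δ) ^ (4 / 5 : ℝ) by ring]
    refine mul_le_mul (by norm_num) (le_mul_of_one_le_right (by positivity) h1) (by positivity)
      (by norm_num)
  · intro n ℓ hn hℓ ε β hε hβ hβ1
    obtain ⟨hdp, α, hα, -, hle, hacc, hrun⟩ :=
      DistRelease.mechanismSpec (δ := 0) hn hℓ hε hβ hβ1
    refine ⟨hdp, α, hα, hle.trans ?_, hacc, hrun⟩
    have hℓ' : (1 : ℝ) ≤ ℓ := by exact_mod_cast hℓ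
    have hL := DistRelease.log_pos_of_inputs hn hℓ hβ hβ1
    -- The error needs only ℓ^(5/3); the remaining factor ℓ^(2/3) of ℓ^(7/3) is at least 1.
    have h1 := Real.one_le_rpow hℓ' (by norm_num : (0 : ℝ) ≤ 2 / 3)
    rw [DistRelease.errorScale_rpow hn hℓ hε hβ hβ1,
      show (7 / 3 : ℝ) = 1 + 2 / 3 + 2 / 3 by norm_num,
      Real.rpow_add (by linarith), Real.rpow_add (by linarith), Real.rpow_one]
    rw [show (ℓ : ℝ) * (ℓ : ℝ) ^ (2 / 3 : ℝ) * (ℓ : ℝ) ^ (2 / 3 : ℝ) *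
        Real.log ((n : ℝ) * ℓ / β) ^ (2 / 3 : ℝ) / ((n : ℝ) ^ (2 / 3 : ℝ) * ε ^ (2 / 3 : ℝ)) =
        ℓ * ((ℓ : ℝ) ^ (2 / 3 : ℝ) * Real.log ((n : ℝ) * ℓ / β) ^ (2 / 3 : ℝ) /
          ((n : ℝ) ^ (2 / 3 : ℝ) * ε ^ (2 / 3 : ℝ))) * (ℓ : ℝ) ^ (2 / 3 : ℝ) by ring]
    refine mul_le_mul (by norm_num) (le_mul_of_one_le_right (by positivity) h1) (by positivity)
      (by norm_num)
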